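/- Let $(Z,d)$ be a nonempty metric space, bounded or unbounded, and $\mu$ a Borel regular measure on $Z$ such that every open ball has positive finite measure and, for some constants $Q>0$ and $C\ge 1$, $\mu(B(\xi,\lambda r))\le C\lambda^Q\mu(B(\xi,r))$ for all $\xi\in Z$, $r>0$, $\lambda\ge 1$. A hyperbolic filling $X$ of $Z$ is defined as follows. If $Z$ is unbounded, choose for each $n\in\mathbb Z$ a maximal set of points $\{\xi_x\}_{x\in X_n}\subset Z$ with pairwise distances at least $2^{-n-1}$, and put $B(x)=B(\xi_x,2^{-n})$ for $x\in X_n$. If $Z$ is bounded, rescale the metric so that $\operatorname{diam}Z=1$ (no rescaling if $Z$ is a single point), do the same for $n\ge 1$ only, and let $X_0$ consist of one vertex $x$ with $B(x)=Z$. Let $X$ be the disjoint union of the sets $X_n$ and write $|x|=n$ for $x\in X_n$. Vertices $x\ne y$ are neighbors, $x\sim y$, if $\big||x|-|y|\big|\le 1$ and $B(x)\cap B(y)\neq\emptyset$. Let $L^1_{\rm loc}(Z)$ be the space of measurable $f:Z\to\mathbb C$ that are integrable on bounded measurable sets. For $f\in L^1_{\rm loc}(Z)$ put $$Pf(x)=\frac1{\mu(B(x))}\int_{B(x)}f\,d\mu,\qquad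 |d(Pf)|(x)=\Big(\sum_{y\sim x}|Pf(y)-Pf(x)|^2\Big)^{1/2}\qquad(x\in X),$$ and for $s>0$ and $Q/(Q+s)<p,q<\infty$ let $\dot F^s_{p,q}(Z)$ be the space of all $f\in L^1_{\rm loc}(Z)$ with $$\|f\|_{\dot F^s_{p,q}(Z)}=\Big(\int_Z\Big(\sum_{x\in X:\ \xi\in B(x)}\big(2^{|x|s}\,|d(Pf)|(x)\big)^q\Big)^{p/q}d\mu(\xi)\Big)^{1/p}<\infty .$$ Suppose that $0<s<1$ and $Q/(Q+s)<p,q<\infty$. Then, for every choice of the hyperbolic filling, the complex-valued Lipschitz functions with bounded support form a dense subset of $\dot F^s_{p,q}(Z)$: each of them belongs to $\dot F^s_{p,q}(Z)$, and for every $f\in\dot F^s_{p,q}(Z)$ and $\varepsilon>0$ there is a Lipschitz function $g:Z\to\mathbb C$ with bounded support such that $\|f-g\|_{\dot F^s_{p,q}(Z)}<\varepsilon$. -/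

import Mathlib

open MeasureTheory
open scoped ENNReal

namespace TriebelLizorkin

/-- The balls of `Z` have positive finite measure and
`μ (B(ξ, lam * r)) ≤ C * lam ^ Q * μ (B(ξ, r))` for all `ξ`, `r > 0`, `lam ≥ 1`. The case `lam = 2`
is the doubling condition. -/
structure IsDoublingMeasure {Z : Type*} [MetricSpace Z] [MeasurableSpace Z]
    (μ : Measure Z) (Q : ℝ) : Prop where
  ball_pos : ∀ (ξ : Z) (r : ℝ), 0 < r → 0 < μ (Metric.ball ξ r)
  ball_lt_top : ∀ (ξ : Z) (r : ℝ), 0 < r → μ (Metric.ball ξ r) < ∞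
  exponent_pos : 0 < Q
  doubling : ∃ C : ℝ, 1 ≤ C ∧ ∀ (ξ : Z) (r lam : ℝ), 0 < r → 1 ≤ lam →
    μ (Metric.ball ξ (lam * r)) ≤ ENNReal.ofReal (C * lam ^ Q) * μ (Metric.ball ξ r)

/-- `N` is a maximal set of points with pairwise distances at least `ε`. -/
def IsMaximalSeparated {Z : Type*} [MetricSpace Z] (N : Set Z) (ε : ℝ) : Prop :=
  Maximal (fun M : Set Z => M.Pairwise fun a b => ε ≤ dist a b) N

open Classical in
/-- The unit of length: the diameter of `Z` if `Z` is bounded with more than one point, so that `Z`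
has diameter one in this unit, and `1` otherwise (`Metric.diam` of an unbounded set is `0`). -/
noncomputable def unitLength (Z : Type*) [MetricSpace Z] : ℝ :=
  if Metric.diam (Set.univ : Set Z) = 0 then 1 else Metric.diam (Set.univ : Set Z)

/-- A hyperbolic filling of `Z`, given by the set `net n` of the centers of its vertices of level
`n`. If `Z` is unbounded, `net n` is a maximal `2 ^ (-n-1)`-separated set for all integers `n`. If
`Z` is bounded, distances are measured in the unit `unitLength Z`, this is required for
`n ≥ 1` only, there is exactly one vertex of level `0`, and there are none of negative level. -/
structure HyperbolicFilling (Z : Type*) [MetricSpace Z] where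
  net : ℤ → Set Z
  net_maximal : ∀ n : ℤ, (BoundedSpace Z → 1 ≤ n) →
    IsMaximalSeparated (net n) (unitLength Z * (2 : ℝ) ^ (-n - 1))
  net_zero : BoundedSpace Z → ∃ z : Z, net 0 = {z}
  net_neg : BoundedSpace Z → ∀ n : ℤ, n < 0 → net n = ∅

namespace HyperbolicFilling

variable {Z : Type*} [MetricSpace Z] (X : HyperbolicFilling Z)

/-- The vertices of the filling: the disjoint union of the levels. -/
abbrev Vertex : Type _ := Σ n : ℤ, X.net n

/-- The level `|x|` of a vertex. -/
def level (x : X.Vertex) : ℤ := x.1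

open Classical in
/-- The set `B(x)`: the ball about the center of `x` of radius `2 ^ (-|x|)` (in the unit of length),
except that it is all of `Z` for the vertex of level `0` when `Z` is bounded. -/
noncomputable def ball (x : X.Vertex) : Set Z :=
  if BoundedSpace Z ∧ X.level x = 0 then Set.univ
  else Metric.ball (x.2 : Z) (unitLength Z * (2 : ℝ) ^ (-X.level x))

/-- The edges: distinct vertices whose levels differ by at most one and whose balls meet. -/
def Adj (x y : X.Vertex) : Prop :=
  x ≠ y ∧ |X.level x - X.level y| ≤ 1 ∧ (X.ball x ∩ X.ball y).Nonempty

/-- The pointwise norm `|du|(x) = (∑_{y ∼ x} |u y - u x| ^ 2) ^ (1/2)` of the discrete derivative. -/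
noncomputable def derivNorm (u : X.Vertex → ℂ) (x : X.Vertex) : ℝ≥0∞ :=
  (∑' y : {y : X.Vertex // X.Adj x y}, ‖u y.1 - u x‖ₑ ^ 2) ^ (1 / 2 : ℝ)

/-- The quasi-norm of the sequence space `J^s_{p,q}(X)`, for a sequence with moduli `w` and for
finite `q`; the sum is over the cone of the vertices `x` with `ξ ∈ B(x)`. -/
noncomputable def seqNorm [MeasurableSpace Z] (μ : Measure Z) (s p q : ℝ)
    (w : X.Vertex → ℝ≥0∞) : ℝ≥0∞ :=
  (∫⁻ ξ, ((∑' x : {x : X.Vertex // ξ ∈ X.ball x},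
    ((2 : ℝ≥0∞) ^ ((X.level x.1 : ℝ) * s) * w x.1) ^ q) ^ (1 / q)) ^ p ∂μ) ^ (1 / p)

/-- The Poisson extension: `Pf(x)` is the mean value of `f` over `B(x)`. -/
noncomputable def poisson [MeasurableSpace Z] (μ : Measure Z) (f : Z → ℂ) (x : X.Vertex) : ℂ :=
  ⨍ ξ in X.ball x, f ξ ∂μ

/-- The Triebel–Lizorkin quasi-norm `‖d(Pf)‖` in `J^s_{p,q}(X)`, for finite `q`. -/
noncomputable def tlNorm [MeasurableSpace Z] (μ : Measure Z) (s p q : ℝ) (f : Z → ℂ) : ℝ≥0∞ :=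
  X.seqNorm μ s p q (X.derivNorm (X.poisson μ f))

end HyperbolicFilling

/-- `f` is measurable, and integrable on the bounded measurable subsets of `Z`. -/
def IsLocInt {Z : Type*} [MetricSpace Z] [MeasurableSpace Z] (μ : Measure Z) (f : Z → ℂ) : Prop :=
  AEStronglyMeasurable f μ ∧
    ∀ A : Set Z, Bornology.IsBounded A → MeasurableSet A → IntegrableOn f A μ

/-- The Triebel–Lizorkin space, as the set of functions `f` in `L^1_loc(Z)` of finite quasi-norm. -/
def tlSpace {Z : Type*} [MetricSpace Z] [MeasurableSpace Z] (μ : Measure Z)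
    (X : HyperbolicFilling Z) (s p q : ℝ) : Set (Z → ℂ) :=
  {f | IsLocInt μ f ∧ X.tlNorm μ s p q f < ∞}

/-- The complex-valued Lipschitz functions with bounded support. -/
def lipBounded (Z : Type*) [MetricSpace Z] : Set (Z → ℂ) :=
  {g | (∃ K, LipschitzWith K g) ∧ Bornology.IsBounded (Function.support g)}

end TriebelLizorkin

namespace TriebelLizorkin

open Filter Topology Metric Set

set_option linter.unusedSectionVars false

/-! Let T_n f be the interpolation of the level-n values of Pf by normalized tent functions of width
2^{-n}. For f of finite quasi-norm the errors are measured by D_n, the sum over levels |x| ≥ n of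
2^{-δ(|x|-n)} times the p-mass of |d(Pf)| at x (`decay`). D_n tends to 0 both as n → ∞ and as n →
-∞.

Two estimates carry the proof. Below level n + 5, telescoping T_{n+j} f - T_{n+j+1} f and Lebesgue
differentiation bound |f - T_n f| by the cone sum of 2|d(Pf)| over levels ≥ n
(`dominatedFrom_sub_interp`). Averaging such a function over coarse balls costs at most a factor
2^{σ} per level in p-th power whenever Q(1-p) ≤ σ. The condition p > Q/(Q+s) says exactly that
Q(1-p) < sp, so σ can be taken below sp, and δ = sp - σ > 0 leaves geometric decay
(`energy_low_le`). From level n + 5 on, T_n f is Lipschitz at scale 2^{-n} and its discrete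
derivative at level k gains 2^{n-k}, which beats 2^{(k-n)s} because s < 1 (`energy_high_le`). Both
estimates are made in the Besov scale, level by level. The passage from the Triebel–Lizorkin energy
costs only an arbitrarily small weight 2^{δ|k-N|} (`energy_le_mass`), which the geometric decay
absorbs, so no maximal function is needed.

Hence f - T_n f is small as n → ∞ and, for unbounded Z, T_n f is small as n → -∞
(`energy_sub_interp_le`). For unbounded Z replace f by g = f - T_n f with n very negative; the p-th
powers of its averages at any level N are summable against the measures of the balls
(`exists_summable_approx`). If Z is bounded, g = f has this property. For N large T_N g is close to
g, and cutting its coefficients off outside a finite set changes it little (`energy_interp_le`) and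
gives a Lipschitz function of bounded support. -/

/-! ### Sums and powers in the extended nonnegative reals -/

theorem two_rpow_add (a b : ℝ) : (2 : ℝ≥0∞) ^ (a + b) = 2 ^ a * 2 ^ b :=
  ENNReal.rpow_add a b two_ne_zero ENNReal.ofNat_ne_top

theorem two_rpow_mono {a b : ℝ} (h : a ≤ b) : (2 : ℝ≥0∞) ^ a ≤ 2 ^ b :=
  ENNReal.rpow_le_rpow_of_exponent_le one_le_two h

theorem two_rpow_ne_top (a : ℝ) : (2 : ℝ≥0∞) ^ a ≠ ∞ :=
  ENNReal.rpow_ne_top_of_ne_zero two_ne_zero ENNReal.ofNat_ne_top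

theorem two_rpow_ne_zero (a : ℝ) : (2 : ℝ≥0∞) ^ a ≠ 0 :=
  (ENNReal.rpow_pos two_pos ENNReal.ofNat_ne_top).ne'

theorem add_rpow_le {t : ℝ} (ht : 0 ≤ t) (a b : ℝ≥0∞) :
    (a + b) ^ t ≤ 2 ^ t * (a ^ t + b ^ t) := by
  have h : a + b ≤ 2 * max a b := by
    rw [two_mul]; exact add_le_add (le_max_left _ _) (le_max_right _ _)
  refine (ENNReal.rpow_le_rpow h ht).trans ?_
  rw [ENNReal.mul_rpow_of_nonneg _ _ ht]
  gcongr
  rcases le_total a b with hab | hab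
  · rw [max_eq_right hab]; exact le_add_self
  · rw [max_eq_left hab]; exact le_self_add

theorem tsum_rpow_le_of_sum {ι : Type*} {t : ℝ} (c : ι → ℝ≥0∞) {B : ℝ≥0∞}
    (h : ∀ s : Finset ι, (∑ i ∈ s, c i) ^ t ≤ B) : (∑' i, c i) ^ t ≤ B := by
  have h1 : Tendsto (fun s : Finset ι => (∑ i ∈ s, c i) ^ t) atTop (𝓝 ((∑' i, c i) ^ t)) :=
    (ENNReal.continuous_rpow_const.tendsto _).comp ENNReal.summable.hasSum
  exact le_of_tendsto' h1 h

theorem rpow_sum_le {ι : Type*} {t : ℝ} (ht : 0 < t) (ht1 : t ≤ 1) (c : ι → ℝ≥0∞)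
    (s : Finset ι) : (∑ i ∈ s, c i) ^ t ≤ ∑ i ∈ s, c i ^ t := by
  classical
  induction s using Finset.induction_on with
  | empty => simp [ht]
  | insert a s ha ih =>
    rw [Finset.sum_insert ha, Finset.sum_insert ha]
    exact (ENNReal.rpow_add_le_add_rpow _ _ ht.le ht1).trans (by gcongr)

/-- Hölder's inequality for `t > 1`, and subadditivity of `c ↦ c ^ t` for `t ≤ 1`. -/
theorem rpow_tsum_le_weighted {ι : Type*} {t : ℝ} (ht : 0 < t) (c θ : ι → ℝ≥0∞) (S : Set ι)
    (hc : ∀ i ∉ S, c i = 0) (hθ0 : ∀ i ∈ S, θ i ≠ 0) (hθt : ∀ i ∈ S, θ i ≠ ∞) {K : ℝ≥0∞}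
    (h1 : t ≤ 1 → ∀ i ∈ S, 1 ≤ K * θ i)
    (h2 : 1 < t → (∑' i, S.indicator (fun i => θ i ^ (-1 / (t - 1))) i) ^ (t - 1) ≤ K) :
    (∑' i, c i) ^ t ≤ K * ∑' i, θ i * c i ^ t := by
  classical
  refine tsum_rpow_le_of_sum c fun s => ?_
  rcases le_or_gt t 1 with h | h
  · refine (rpow_sum_le ht h c s).trans ?_
    rw [← ENNReal.tsum_mul_left]
    refine le_trans ?_ (ENNReal.sum_le_tsum s)
    refine Finset.sum_le_sum fun i _ => ?_
    by_cases hi : i ∈ S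
    · rw [← mul_assoc]
      exact le_mul_of_one_le_left (zero_le) (h1 h i hi)
    · simp [hc i hi, ht]
  · have ht1 : 0 < t - 1 := by linarith
    have hpq : t.HolderConjugate (t / (t - 1)) := Real.HolderConjugate.conjExponent h
    -- Hölder is applied to the product of θ^(1/t) c and θ^(-1/t); the second factor is cut off to
    -- S, where θ is nonzero and finite.
    set g : ι → ℝ≥0∞ := S.indicator fun i => θ i ^ (-1 / t)
    have e1 : ∀ i, c i = (θ i ^ (1 / t) * c i) * g i := by
      intro i
      by_cases hi : i ∈ S
      · simp only [g, indicator_of_mem hi]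
        rw [mul_right_comm, ← ENNReal.rpow_add _ _ (hθ0 i hi) (hθt i hi)]
        rw [show 1 / t + -1 / t = 0 by ring]; simp
      · simp [hc i hi]
    have e2 : ∀ i, (θ i ^ (1 / t) * c i) ^ t = θ i * c i ^ t := by
      intro i
      rw [ENNReal.mul_rpow_of_nonneg _ _ ht.le, ← ENNReal.rpow_mul]
      rw [one_div_mul_cancel ht.ne', ENNReal.rpow_one]
    have e3 : ∀ i, g i ^ (t / (t - 1)) = S.indicator (fun i => θ i ^ (-1 / (t - 1))) i := by
      intro i
      by_cases hi : i ∈ S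
      · simp only [g, indicator_of_mem hi]
        rw [← ENNReal.rpow_mul]; congr 1; field_simp
      · simp only [g, indicator_of_notMem hi]
        exact ENNReal.zero_rpow_of_pos (div_pos ht ht1)
    have key := ENNReal.inner_le_Lp_mul_Lq s (fun i => θ i ^ (1 / t) * c i) g hpq
    simp only [← e1, e2, e3] at key
    refine (ENNReal.rpow_le_rpow key ht.le).trans ?_
    rw [ENNReal.mul_rpow_of_nonneg _ _ ht.le, ← ENNReal.rpow_mul, ← ENNReal.rpow_mul,
      one_div_mul_cancel ht.ne', ENNReal.rpow_one, mul_comm]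
    rw [show 1 / (t / (t - 1)) * t = t - 1 by field_simp]
    refine mul_le_mul' (le_trans ?_ (h2 h)) (ENNReal.sum_le_tsum s)
    exact ENNReal.rpow_le_rpow (ENNReal.sum_le_tsum s) ht1.le

theorem tsum_two_rpow_abs {ε : ℝ} (hε : 0 < ε) :
    ∃ C : ℝ≥0∞, C ≠ ∞ ∧ ∀ N : ℤ, ∑' k : ℤ, (2 : ℝ≥0∞) ^ (-ε * |(k : ℝ) - N|) ≤ C := by
  have hr : Summable fun k : ℤ => (2 : ℝ) ^ (-ε * |(k : ℝ)|) := by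
    have hg : Summable fun n : ℕ => ((2 : ℝ) ^ (-ε)) ^ n :=
      summable_geometric_of_lt_one (by positivity)
        (Real.rpow_lt_one_of_one_lt_of_neg one_lt_two (by linarith))
    have he : ∀ n : ℕ, ((2 : ℝ) ^ (-ε)) ^ n = (2 : ℝ) ^ (-ε * n) := fun n => by
      rw [Real.rpow_mul two_pos.le, Real.rpow_natCast]
    refine Summable.of_nat_of_neg ?_ ?_ <;> simpa [he] using hg
  refine ⟨ENNReal.ofReal (∑' k : ℤ, (2 : ℝ) ^ (-ε * |(k : ℝ)|)), ENNReal.ofReal_ne_top, fun N => ?_⟩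
  rw [ENNReal.ofReal_tsum_of_nonneg (fun _ => by positivity) hr,
    ← (Equiv.subRight N).tsum_eq (fun k : ℤ => ENNReal.ofReal ((2 : ℝ) ^ (-ε * |(k : ℝ)|)))]
  refine ENNReal.tsum_le_tsum fun k => ?_
  rw [← ENNReal.ofReal_rpow_of_pos two_pos]
  simp

/-! ### Geometry of the filling and of doubling measures -/

section Geometry

variable {Z : Type*} [MetricSpace Z]

theorem unitLength_pos (Z : Type*) [MetricSpace Z] : 0 < unitLength Z := by
  unfold unitLength
  split_ifs with h
  · exact one_pos
  · exact lt_of_le_of_ne diam_nonneg (Ne.symm h)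

/-- The radius of the balls of level `n`. -/
noncomputable def scale (Z : Type*) [MetricSpace Z] (n : ℤ) : ℝ := unitLength Z * (2 : ℝ) ^ (-n)

theorem scale_pos (n : ℤ) : 0 < scale Z n := mul_pos (unitLength_pos Z) (by positivity)

theorem scale_eq (m k : ℤ) : scale Z k = (2 : ℝ) ^ (m - k) * scale Z m := by
  unfold scale
  rw [mul_left_comm, ← zpow_add₀ two_ne_zero]
  congr 2; ring

theorem scale_le {m k j : ℤ} (h : k ≤ m + j) : scale Z m ≤ (2 : ℝ) ^ j * scale Z k := by
  rw [scale_eq k m]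
  exact mul_le_mul_of_nonneg_right (zpow_le_zpow_right₀ one_le_two (by linarith)) (scale_pos k).le

theorem scale_anti {m k : ℤ} (h : k ≤ m) : scale Z m ≤ scale Z k := by
  simpa using scale_le (Z := Z) (m := m) (k := k) (j := 0) (by simpa using h)

theorem tendsto_scale : Tendsto (fun n : ℕ => scale Z (n : ℤ)) atTop (𝓝 0) := by
  have h : Tendsto (fun n : ℕ => unitLength Z * ((1 / 2 : ℝ)) ^ n) atTop (𝓝 (unitLength Z * 0)) :=
    (tendsto_pow_atTop_nhds_zero_of_lt_one (by norm_num) (by norm_num)).const_mul _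
  rw [mul_zero] at h
  refine h.congr fun n => ?_
  simp [scale]

variable (X : HyperbolicFilling Z)

namespace HyperbolicFilling

/-- The center of the ball of a vertex. -/
def center (x : X.Vertex) : Z := x.2

/-- The factor 2 makes room for the vertex of level 0 of a bounded space, whose set is all of `Z`;
this treats all vertices uniformly afterwards. -/
theorem ball_subset (x : X.Vertex) : X.ball x ⊆ Metric.ball (X.center x) (2 * scale Z (X.level x)) := by
  unfold ball
  split_ifs with h
  · intro z _
    have hu := unitLength_pos Z
    rw [h.2, mem_ball]
    have : scale Z 0 = unitLength Z := by simp [scale]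
    rw [this]
    have hb : BoundedSpace Z := h.1
    have hd : dist z (X.center x) ≤ diam (univ : Set Z) :=
      dist_le_diam_of_mem (Bornology.IsBounded.all _) (mem_univ _) (mem_univ _)
    have : diam (univ : Set Z) ≤ unitLength Z := by
      unfold unitLength; split_ifs with h0
      · rw [h0]; exact zero_le_one
      · exact le_rfl
    linarith
  · have := scale_pos (Z := Z) (X.level x)
    exact ball_subset_ball (by change scale Z (X.level x) ≤ _; linarith)

theorem subset_ball (x : X.Vertex) : Metric.ball (X.center x) (scale Z (X.level x)) ⊆ X.ball x := by
  unfold ball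
  split_ifs with h
  · exact subset_univ _
  · exact subset_rfl

theorem isOpen_ball (x : X.Vertex) : IsOpen (X.ball x) := by
  unfold ball
  split_ifs
  · exact isOpen_univ
  · exact Metric.isOpen_ball

theorem isBounded_ball (x : X.Vertex) : Bornology.IsBounded (X.ball x) :=
  Metric.isBounded_ball.subset (X.ball_subset x)

/-- The levels at which the net is maximal. -/
def IsFull (_ : HyperbolicFilling Z) (n : ℤ) : Prop := BoundedSpace Z → 1 ≤ n

theorem IsFull.mono {X : HyperbolicFilling Z} {m n : ℤ} (hm : X.IsFull m) (h : m ≤ n) :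
    X.IsFull n := fun hb => (hm hb).trans h

theorem half_scale (n : ℤ) : unitLength Z * (2 : ℝ) ^ (-n - 1) = scale Z n / 2 := by
  unfold scale; rw [zpow_sub_one₀ two_ne_zero]; ring

/-- Separation needs no fullness: at the remaining levels the net has at most one point. -/
theorem net_separated (n : ℤ) : (X.net n).Pairwise fun a b => scale Z n / 2 ≤ dist a b := by
  by_cases h : X.IsFull n
  · rw [← half_scale]; exact (X.net_maximal n h).1
  · simp only [IsFull, Classical.not_imp, not_le] at h
    rcases lt_or_eq_of_le (Int.lt_add_one_iff.1 (by simpa using h.2) : n ≤ 0) with h0 | h0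
    · rw [X.net_neg h.1 n h0]; exact pairwise_empty _
    · obtain ⟨z, hz⟩ := X.net_zero h.1
      rw [h0, hz]; exact pairwise_singleton _ _

theorem exists_dist_lt {n : ℤ} (hn : X.IsFull n) (ξ : Z) :
    ∃ x : X.net n, dist ξ x < scale Z n / 2 := by
  by_contra! h
  have hm := X.net_maximal n hn
  rw [half_scale] at hm
  have hins : (insert ξ (X.net n)).Pairwise fun a b => scale Z n / 2 ≤ dist a b := by
    refine hm.1.insert fun b hb _ => ⟨h ⟨b, hb⟩, ?_⟩
    rw [dist_comm]; exact h ⟨b, hb⟩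
  have hmem : ξ ∈ X.net n := hm.2 hins (subset_insert _ _) (mem_insert _ _)
  have := h ⟨ξ, hmem⟩
  have := scale_pos (Z := Z) n
  simp at *
  linarith

end HyperbolicFilling

variable [MeasurableSpace Z] [BorelSpace Z] {μ : Measure Z} {Q : ℝ}

theorem HyperbolicFilling.measurableSet_ball (x : X.Vertex) : MeasurableSet (X.ball x) :=
  (X.isOpen_ball x).measurableSet

namespace IsDoublingMeasure

variable (hμ : IsDoublingMeasure μ Q)
include hμ

theorem ball_le (K : ℝ) (j : ℤ) : ∃ C : ℝ≥0∞, C ≠ ∞ ∧ ∀ (a b : Z) (m k : ℤ),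
    dist a b < K * scale Z k → k ≤ m + j →
    μ (ball b (K * scale Z k)) ≤ C * 2 ^ (((m : ℝ) - k) * Q) * μ (ball a (scale Z m)) := by
  obtain ⟨C₀, hC₀, hd⟩ := hμ.doubling
  -- `2 * |K|` covers the distance of the centers plus the radius; `2 ^ j` makes the dilation factor
  -- at least 1 although level `m` may be coarser than `k` by up to `j`.
  set K' : ℝ := 2 * |K| + (2 : ℝ) ^ j with hK'
  have hjp : (0 : ℝ) < (2 : ℝ) ^ j := by positivity
  have hKp : 0 < K' := by positivity
  refine ⟨ENNReal.ofReal (C₀ * K' ^ Q), ENNReal.ofReal_ne_top, fun a b m k hab hk => ?_⟩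
  have hs := scale_pos (Z := Z) k
  have hsub : ball b (K * scale Z k) ⊆ ball a (K' * (2 : ℝ) ^ (m - k) * scale Z m) := by
    rw [mul_assoc, ← scale_eq]
    apply ball_subset_ball'
    rw [dist_comm]
    have : K * scale Z k ≤ |K| * scale Z k := mul_le_mul_of_nonneg_right (le_abs_self K) hs.le
    have : 0 < (2 : ℝ) ^ j * scale Z k := by positivity
    rw [hK']; linarith
  have hlam : 1 ≤ K' * (2 : ℝ) ^ (m - k) := by
    calc (1 : ℝ) ≤ (2 : ℝ) ^ (j + (m - k)) := one_le_zpow₀ one_le_two (by linarith)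
      _ = (2 : ℝ) ^ j * (2 : ℝ) ^ (m - k) := zpow_add₀ two_ne_zero _ _
      _ ≤ _ := by gcongr; rw [hK']; linarith [abs_nonneg K]
  refine (measure_mono hsub).trans ((hd a _ _ (scale_pos m) hlam).trans (le_of_eq ?_))
  congr 1
  rw [Real.mul_rpow hKp.le (by positivity), ← mul_assoc, ENNReal.ofReal_mul (by positivity)]
  congr 1
  rw [← Real.rpow_intCast, ← Real.rpow_mul two_pos.le, ← ENNReal.ofReal_rpow_of_pos two_pos]
  simp

theorem measure_ne_zero (x : X.Vertex) : μ (X.ball x) ≠ 0 :=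
  ((hμ.ball_pos _ _ (scale_pos _)).trans_le (measure_mono (X.subset_ball x))).ne'

theorem measure_ne_top (x : X.Vertex) : μ (X.ball x) ≠ ∞ :=
  ((measure_mono (X.ball_subset x)).trans_lt
    (hμ.ball_lt_top _ _ (mul_pos two_pos (scale_pos _)))).ne

/-- By separation the balls of a quarter of the scale about the net points are disjoint, and by
doubling each carries a fixed share of the measure of its vertex ball. -/
theorem packing : ∃ C : ℝ≥0∞, C ≠ ∞ ∧ ∀ (m : ℤ) (η : Z) (ρ : ℝ),
    ∑' x : X.net m, (if dist (x : Z) η < ρ then μ (X.ball ⟨m, x⟩) else 0) ≤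
      C * μ (ball η (ρ + scale Z m)) := by
  obtain ⟨C, hC, h⟩ := hμ.ball_le 2 2
  refine ⟨C * 2 ^ (2 * Q), by finiteness [two_rpow_ne_top (2 * Q)], fun m η ρ => ?_⟩
  set S : X.net m → Set Z := fun x => if dist (x : Z) η < ρ then ball (x : Z) (scale Z (m + 2)) else ∅
  have hs4 : scale Z (m + 2) = scale Z m / 4 := by
    rw [scale_eq m (m + 2)]; norm_num; ring
  have hsp := scale_pos (Z := Z) m
  have hmeas : ∀ x, MeasurableSet (S x) := fun x => by
    simp only [S]; split_ifs
    · exact measurableSet_ball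
    · exact MeasurableSet.empty
  have hdisj : Pairwise (Function.onFun Disjoint S) := by
    intro x y hxy
    simp only [Function.onFun, S]
    split_ifs <;> try exact disjoint_bot_left
    all_goals try exact disjoint_bot_right
    apply ball_disjoint_ball
    have := X.net_separated m x.2 y.2 (fun h => hxy (Subtype.ext h))
    linarith
  have hsub : (⋃ x, S x) ⊆ ball η (ρ + scale Z m) := by
    refine iUnion_subset fun x => ?_
    simp only [S]; split_ifs with hx
    · apply ball_subset_ball'; linarith
    · exact empty_subset _
  calc ∑' x : X.net m, (if dist (x : Z) η < ρ then μ (X.ball ⟨m, x⟩) else 0)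
      ≤ ∑' x : X.net m, C * 2 ^ (2 * Q) * μ (S x) := by
        refine ENNReal.tsum_le_tsum fun x => ?_
        simp only [S]
        split_ifs
        · refine (measure_mono (X.ball_subset ⟨m, x⟩)).trans ?_
          have := h x x (m + 2) m (by rw [dist_self]; positivity) (by omega)
          refine this.trans (le_of_eq ?_)
          push_cast; congr 3; ring
        · exact zero_le
    _ = C * 2 ^ (2 * Q) * ∑' x, μ (S x) := ENNReal.tsum_mul_left
    _ ≤ _ := by
        gcongr
        exact (tsum_meas_le_meas_iUnion_of_disjoint μ hmeas hdisj).trans (measure_mono hsub)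

theorem overlap (K : ℝ) : ∃ C : ℝ≥0∞, C ≠ ∞ ∧ ∀ (n : ℤ) (ξ : Z),
    ∑' x : X.net n, (if dist (x : Z) ξ < K * scale Z n then 1 else 0) ≤ C := by
  obtain ⟨C₁, hC₁, h₁⟩ := hμ.ball_le (|K| + 1) 0
  obtain ⟨C₂, hC₂, h₂⟩ := hμ.packing X
  refine ⟨C₁ * C₂, by finiteness, fun n ξ => ?_⟩
  have hsp := scale_pos (Z := Z) n
  have hpos : 0 < (|K| + 1) * scale Z n := by positivity
  set B := μ (ball ξ ((|K| + 1) * scale Z n)) with hB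
  have hB0 : B ≠ 0 := (hμ.ball_pos _ _ hpos).ne'
  have hBt : B ≠ ∞ := (hμ.ball_lt_top _ _ hpos).ne
  -- Multiplied by `B`, the count becomes a sum of ball measures, since each nearby ball has measure
  -- comparable to `B`; then packing applies.
  refine (ENNReal.mul_le_mul_iff_left hB0 hBt).1 ?_
  rw [← ENNReal.tsum_mul_right]
  have hK : K * scale Z n ≤ |K| * scale Z n := mul_le_mul_of_nonneg_right (le_abs_self K) hsp.le
  calc ∑' x : X.net n, (if dist (x : Z) ξ < K * scale Z n then (1 : ℝ≥0∞) else 0) * B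
      ≤ ∑' x : X.net n, C₁ * (if dist (x : Z) ξ < |K| * scale Z n then μ (X.ball ⟨n, x⟩) else 0) := by
        refine ENNReal.tsum_le_tsum fun x => ?_
        split_ifs with h h'
        · have := h₁ x ξ n n (by linarith) (by simp)
          simp only [sub_self, zero_mul, ENNReal.rpow_zero, mul_one] at this
          rw [one_mul]
          refine this.trans ?_
          gcongr
          exact X.subset_ball ⟨n, x⟩
        · exact absurd (h.trans_le hK) h'
        · simp
        · simp
    _ ≤ C₁ * (C₂ * B) := by
        rw [ENNReal.tsum_mul_left]
        gcongr
        refine (h₂ n ξ _).trans (le_of_eq ?_)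
        rw [hB]; congr 3; ring
    _ = _ := (mul_assoc _ _ _).symm

theorem finite_near (n : ℤ) (ξ : Z) (R : ℝ) : {x : X.net n | dist (x : Z) ξ < R}.Finite := by
  obtain ⟨C, hC, h⟩ := hμ.overlap X (R / scale Z n)
  have h' := h n ξ
  rw [div_mul_cancel₀ _ (scale_pos n).ne'] at h'
  refine (ENNReal.finite_const_le_of_tsum_ne_top (ne_top_of_le_ne_top hC h') one_ne_zero).subset ?_
  intro x hx
  simp only [mem_ofPred_eq] at hx ⊢
  rw [if_pos hx]

theorem countable_net (n : ℤ) : Countable (X.net n) := by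
  rcases isEmpty_or_nonempty (X.net n) with h | ⟨⟨ξ⟩⟩
  · infer_instance
  · rw [← countable_univ_iff]
    have : (univ : Set (X.net n)) ⊆ ⋃ R : ℕ, {x : X.net n | dist (x : Z) (ξ : Z) < R} := by
      intro x _
      obtain ⟨R, hR⟩ := exists_nat_gt (dist (x : Z) (ξ : Z))
      exact mem_iUnion.2 ⟨R, hR⟩
    exact (countable_iUnion fun R : ℕ => (hμ.finite_near X n ξ R).countable).mono this

theorem countable_vertex : Countable X.Vertex := by
  have := hμ.countable_net X
  infer_instance

include X in
theorem secondCountable : SecondCountableTopology Z := by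
  have hsep : TopologicalSpace.SeparableSpace Z := by
    -- The levels from 1 on are full whether or not `Z` is bounded.
    refine ⟨⋃ n : ℕ, X.net ((n : ℤ) + 1), countable_iUnion fun n => ?_, ?_⟩
    · exact countable_coe_iff.1 (hμ.countable_net X _)
    · refine dense_iff.2 fun ξ ε hε => ?_
      obtain ⟨N, hN⟩ := (tendsto_scale (Z := Z)).eventually (gt_mem_nhds hε) |>.exists
      obtain ⟨x, hx⟩ := X.exists_dist_lt (n := (N : ℤ) + 1) (fun _ => by omega) ξ
      refine ⟨x, ?_, mem_iUnion.2 ⟨N, x.2⟩⟩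
      have h1 := scale_anti (Z := Z) (m := (N : ℤ) + 1) (k := N) (by omega)
      have := scale_pos (Z := Z) ((N : ℤ) + 1)
      rw [mem_ball, dist_comm]
      linarith
  exact UniformSpace.secondCountable_of_separable Z

/-- Gives access to the Lebesgue differentiation theorem for `μ`. -/
theorem isUnifLocDoublingMeasure : IsUnifLocDoublingMeasure μ := by
  obtain ⟨C₀, hC₀, hd⟩ := hμ.doubling
  refine ⟨⟨(C₀ * 4 ^ Q).toNNReal, ?_⟩⟩
  filter_upwards [self_mem_nhdsWithin] with ε hε x
  have hε' : 0 < ε := hε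
  calc μ (closedBall x (2 * ε)) ≤ μ (ball x (4 * ε)) := by
        gcongr; exact closedBall_subset_ball (by linarith)
    _ ≤ ENNReal.ofReal (C₀ * 4 ^ Q) * μ (ball x ε) := hd x ε 4 hε' (by norm_num)
    _ ≤ _ := by
        gcongr
        · exact le_rfl
        · exact ball_subset_closedBall

theorem isLocallyFiniteMeasure : IsLocallyFiniteMeasure μ :=
  ⟨fun x => ⟨ball x 1, ball_mem_nhds x one_pos, hμ.ball_lt_top x 1 one_pos⟩⟩

end IsDoublingMeasure

end Geometry

/-- Dominated convergence for the counting measure. -/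
theorem tendsto_tsum_zero_of_eventually {ι κ : Type*} {l : Filter κ} [l.IsCountablyGenerated]
    {g : ι → ℝ≥0∞} (hg : ∑' i, g i ≠ ∞) {F : κ → ι → ℝ≥0∞} (hF : ∀ n i, F n i ≤ g i)
    (h : ∀ i, ∀ᶠ n in l, F n i = 0) : Tendsto (fun n => ∑' i, F n i) l (𝓝 0) := by
  let _ : MeasurableSpace ι := ⊤
  have key := tendsto_lintegral_filter_of_dominated_convergence (μ := Measure.count) (l := l)
    (F := F) (f := fun _ => 0) g (Eventually.of_forall fun n => measurable_from_top)
    (Eventually.of_forall fun n => Eventually.of_forall (hF n))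
    (by rwa [lintegral_count]) (Eventually.of_forall fun i =>
      tendsto_const_nhds.congr' ((h i).mono fun n hn => hn.symm))
  simpa [lintegral_count] using key

/-! ### The energy, and its comparison with Besov sums -/

section Energy

variable {Z : Type*} [MetricSpace Z] (X : HyperbolicFilling Z)

namespace HyperbolicFilling

theorem Adj.scale_le {X : HyperbolicFilling Z} {x y : X.Vertex} (h : X.Adj x y) :
    scale Z (X.level y) ≤ 2 * scale Z (X.level x) := by
  have := abs_le.1 h.2.1
  simpa using TriebelLizorkin.scale_le (Z := Z) (m := X.level y) (k := X.level x) (j := 1) (by omega)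

theorem Adj.scale_le' {X : HyperbolicFilling Z} {x y : X.Vertex} (h : X.Adj x y) :
    scale Z (X.level x) ≤ 2 * scale Z (X.level y) := by
  have := abs_le.1 h.2.1
  simpa using TriebelLizorkin.scale_le (Z := Z) (m := X.level x) (k := X.level y) (j := 1) (by omega)

theorem Adj.dist_lt {X : HyperbolicFilling Z} {x y : X.Vertex} (h : X.Adj x y) :
    dist (X.center y) (X.center x) < 6 * scale Z (X.level x) := by
  obtain ⟨z, hzx, hzy⟩ := h.2.2
  have h1 := X.ball_subset x hzx
  have h2 := X.ball_subset y hzy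
  rw [mem_ball] at h1 h2
  have := h.scale_le
  linarith [dist_triangle_left (X.center y) (X.center x) z]

/-- The dilation 10 is 6 for the distance of the centers plus 4 for the radius of the neighbor;
`bigAvg` uses the same dilation so that it controls all neighbors. -/
theorem Adj.ball_subset {X : HyperbolicFilling Z} {x y : X.Vertex} (h : X.Adj x y) :
    X.ball y ⊆ Metric.ball (X.center x) (10 * scale Z (X.level x)) := by
  refine (X.ball_subset y).trans (ball_subset_ball' ?_)
  linarith [h.dist_lt, h.scale_le]

theorem enorm_sub_le_derivNorm (u : X.Vertex → ℂ) {x y : X.Vertex} (h : X.Adj x y) :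
    ‖u y - u x‖ₑ ≤ X.derivNorm u x := by
  unfold derivNorm
  calc ‖u y - u x‖ₑ = (‖u y - u x‖ₑ ^ 2) ^ (1 / 2 : ℝ) := by
        rw [← ENNReal.rpow_natCast, ← ENNReal.rpow_mul]; norm_num
    _ ≤ _ := by
        gcongr
        exact ENNReal.le_tsum (f := fun y : {y // X.Adj x y} => ‖u y.1 - u x‖ₑ ^ 2) ⟨y, h⟩

/-- The `p`-th power of the quasi-norm of the sequence space. -/
noncomputable def energy [MeasurableSpace Z] (μ : Measure Z) (s p q : ℝ)
    (w : X.Vertex → ℝ≥0∞) : ℝ≥0∞ :=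
  ∫⁻ ξ, (∑' x, (X.ball x).indicator
    (fun _ => ((2 : ℝ≥0∞) ^ ((X.level x : ℝ) * s) * w x) ^ q) ξ) ^ (p / q) ∂μ

/-- The contribution of the vertex `x` to the `p`-th power of the Besov quasi-norm. -/
noncomputable def mass [MeasurableSpace Z] (μ : Measure Z) (s p : ℝ)
    (w : X.Vertex → ℝ≥0∞) (x : X.Vertex) : ℝ≥0∞ :=
  ((2 : ℝ≥0∞) ^ ((X.level x : ℝ) * s) * w x) ^ p * μ (X.ball x)

open Classical in
/-- The restriction of `w` to the levels that satisfy `P`. -/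
noncomputable def restrict (P : ℤ → Prop) (w : X.Vertex → ℝ≥0∞) (x : X.Vertex) : ℝ≥0∞ :=
  if P (X.level x) then w x else 0

theorem restrict_le (P : ℤ → Prop) (w : X.Vertex → ℝ≥0∞) (x : X.Vertex) :
    X.restrict P w x ≤ w x := by
  unfold restrict; split_ifs
  · exact le_rfl
  · exact zero_le

theorem tsum_vertex (f : X.Vertex → ℝ≥0∞) : ∑' x, f x = ∑' (n : ℤ) (x : X.net n), f ⟨n, x⟩ :=
  ENNReal.tsum_sigma' f

variable [MeasurableSpace Z] {μ : Measure Z} {s p q : ℝ}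

theorem seqNorm_eq (w : X.Vertex → ℝ≥0∞) :
    X.seqNorm μ s p q w = X.energy μ s p q w ^ (1 / p) := by
  unfold seqNorm energy
  congr 2
  ext ξ
  rw [← ENNReal.rpow_mul, one_div_mul_eq_div]
  congr 1
  exact tsum_subtype {x : X.Vertex | ξ ∈ X.ball x}
    (fun x => ((2 : ℝ≥0∞) ^ ((X.level x : ℝ) * s) * w x) ^ q)

theorem energy_mono (hp : 0 < p) (hq : 0 < q) {v w : X.Vertex → ℝ≥0∞} (h : ∀ x, v x ≤ w x) :
    X.energy μ s p q v ≤ X.energy μ s p q w := by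
  unfold energy
  refine lintegral_mono fun ξ => ENNReal.rpow_le_rpow (ENNReal.tsum_le_tsum fun x => ?_)
    (div_pos hp hq).le
  exact indicator_le_indicator (by gcongr; exact h x)

theorem energy_const_mul (hp : 0 < p) (hq : 0 < q) {C : ℝ≥0∞} (hC : C ≠ ∞)
    (w : X.Vertex → ℝ≥0∞) :
    X.energy μ s p q (fun x => C * w x) = C ^ p * X.energy μ s p q w := by
  unfold energy
  rw [← lintegral_const_mul' _ _ (by finiteness)]
  congr 1; ext ξ
  have : ∀ x, (X.ball x).indicator
      (fun _ => ((2 : ℝ≥0∞) ^ ((X.level x : ℝ) * s) * (C * w x)) ^ q) ξ =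
      C ^ q * (X.ball x).indicator
      (fun _ => ((2 : ℝ≥0∞) ^ ((X.level x : ℝ) * s) * w x) ^ q) ξ := by
    intro x
    by_cases h : ξ ∈ X.ball x
    · simp only [indicator_of_mem h]
      rw [mul_left_comm, ENNReal.mul_rpow_of_nonneg _ _ hq.le]
    · simp [indicator_of_notMem h]
  simp only [this, ENNReal.tsum_mul_left]
  rw [ENNReal.mul_rpow_of_nonneg _ _ (by positivity), ← ENNReal.rpow_mul]
  congr 2; field_simp

variable [BorelSpace Z] {Q : ℝ}

theorem measurable_cone [Countable X.Vertex] (f : X.Vertex → ℝ≥0∞) :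
    Measurable fun ξ => ∑' x, (X.ball x).indicator (fun _ => f x) ξ :=
  Measurable.tsum fun x => measurable_const.indicator (X.measurableSet_ball x)

theorem energy_add_le [Countable X.Vertex] (hp : 0 < p) (hq : 0 < q) :
    ∃ C : ℝ≥0∞, C ≠ ∞ ∧ ∀ v w : X.Vertex → ℝ≥0∞,
      X.energy μ s p q (fun x => v x + w x) ≤
        C * (X.energy μ s p q v + X.energy μ s p q w) := by
  have hpq : 0 < p / q := div_pos hp hq
  refine ⟨2 ^ p * 2 ^ (p / q), by finiteness [two_rpow_ne_top], fun v w => ?_⟩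
  unfold energy
  rw [← lintegral_add_left ((X.measurable_cone _).pow_const _),
    ← lintegral_const_mul' _ _ (by finiteness [two_rpow_ne_top])]
  refine lintegral_mono fun ξ => ?_
  set F : (X.Vertex → ℝ≥0∞) → X.Vertex → ℝ≥0∞ := fun u x => (X.ball x).indicator
    (fun _ => ((2 : ℝ≥0∞) ^ ((X.level x : ℝ) * s) * u x) ^ q) ξ with hF
  change (∑' x, F (fun x => v x + w x) x) ^ (p / q) ≤
    2 ^ p * 2 ^ (p / q) * ((∑' x, F v x) ^ (p / q) + (∑' x, F w x) ^ (p / q))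
  have h1 : ∑' x, F (fun x => v x + w x) x ≤ 2 ^ q * (∑' x, F v x + ∑' x, F w x) := by
    rw [← ENNReal.tsum_add, ← ENNReal.tsum_mul_left]
    refine ENNReal.tsum_le_tsum fun x => ?_
    by_cases h : ξ ∈ X.ball x
    · simp only [hF, indicator_of_mem h]
      rw [mul_add]
      exact add_rpow_le hq.le _ _
    · simp [hF, indicator_of_notMem h]
  refine (ENNReal.rpow_le_rpow h1 hpq.le).trans ?_
  rw [ENNReal.mul_rpow_of_nonneg _ _ hpq.le, ← ENNReal.rpow_mul, mul_div_cancel₀ _ hq.ne', mul_assoc]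
  gcongr
  exact add_rpow_le hpq.le _ _

/-- Dominated convergence twice, in the cone over almost every point and then over `Z`. It is used
for the tails at fine levels and for those at coarse levels. -/
theorem tendsto_energy_restrict [Countable X.Vertex] (hp : 0 < p) (hq : 0 < q) {l : Filter ℤ}
    [l.IsCountablyGenerated] {P : ℤ → ℤ → Prop} (hP : ∀ k, ∀ᶠ n in l, ¬ P n k)
    {w : X.Vertex → ℝ≥0∞} (hw : X.energy μ s p q w ≠ ∞) :
    Tendsto (fun n => X.energy μ s p q (X.restrict (P n) w)) l (𝓝 0) := by
  have hpq : 0 < p / q := div_pos hp hq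
  set F : (X.Vertex → ℝ≥0∞) → Z → X.Vertex → ℝ≥0∞ := fun u ξ x => (X.ball x).indicator
    (fun _ => ((2 : ℝ≥0∞) ^ ((X.level x : ℝ) * s) * u x) ^ q) ξ with hF
  have hle : ∀ n ξ x, F (X.restrict (P n) w) ξ x ≤ F w ξ x := fun n ξ x =>
    indicator_le_indicator (by gcongr; exact X.restrict_le _ _ x)
  have key := tendsto_lintegral_filter_of_dominated_convergence (μ := μ) (l := l)
    (F := fun n ξ => (∑' x, F (X.restrict (P n) w) ξ x) ^ (p / q)) (f := fun _ => 0)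
    (fun ξ => (∑' x, F w ξ x) ^ (p / q))
    (Eventually.of_forall fun n => (X.measurable_cone _).pow_const _)
    (Eventually.of_forall fun n => Eventually.of_forall fun ξ =>
      ENNReal.rpow_le_rpow (ENNReal.tsum_le_tsum (hle n ξ)) hpq.le) hw ?_
  · rw [lintegral_zero] at key
    exact key
  · filter_upwards [ae_lt_top ((X.measurable_cone _).pow_const _) hw] with ξ hξ
    have hfin : ∑' x, F w ξ x ≠ ∞ := fun h => by
      have h' : (∑' x, F w ξ x) ^ (p / q) < ∞ := hξ
      rw [h, ENNReal.top_rpow_of_pos hpq] at h'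
      exact lt_irrefl _ h'
    have h0 := tendsto_tsum_zero_of_eventually (l := l) hfin
      (F := fun n => F (X.restrict (P n) w) ξ) (fun n x => hle n ξ x) (fun x => by
        filter_upwards [hP (X.level x)] with n hn
        by_cases h : ξ ∈ X.ball x
        · simp [hF, restrict, hn, hq]
        · simp [hF, indicator_of_notMem h])
    have h1 := (ENNReal.continuous_rpow_const (y := p / q)).tendsto 0 |>.comp h0
    rwa [ENNReal.zero_rpow_of_pos hpq] at h1

end HyperbolicFilling

namespace IsDoublingMeasure

variable [MeasurableSpace Z] [BorelSpace Z] {μ : Measure Z} {s p q Q : ℝ}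
variable (hμ : IsDoublingMeasure μ Q)
include hμ

theorem cone_overlap : ∃ C : ℝ≥0∞, C ≠ ∞ ∧ ∀ (n : ℤ) (ξ : Z),
    ∑' x : X.net n, (X.ball ⟨n, x⟩).indicator (fun _ => (1 : ℝ≥0∞)) ξ ≤ C := by
  obtain ⟨C, hC, h⟩ := hμ.overlap X 2
  refine ⟨C, hC, fun n ξ => le_trans (ENNReal.tsum_le_tsum fun x => ?_) (h n ξ)⟩
  by_cases hx : ξ ∈ X.ball ⟨n, x⟩
  · have := X.ball_subset _ hx
    rw [mem_ball, dist_comm] at this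
    change dist (x : Z) ξ < 2 * scale Z n at this
    rw [if_pos this, indicator_of_mem hx]
  · rw [indicator_of_notMem hx]; exact zero_le

/-- Weighted Hölder with exponent `p / q` in each cone, followed by integration. A cone has
boundedly many vertices on each level, so the dual weights, geometric in the level, have a bounded
sum. -/
theorem energy_le_mass (hp : 0 < p) (hq : 0 < q) {δ : ℝ} (hδ : 0 < δ) :
    ∃ C : ℝ≥0∞, C ≠ ∞ ∧ ∀ (N : ℤ) (w : X.Vertex → ℝ≥0∞),
      X.energy μ s p q w ≤
        C * ∑' x, (2 : ℝ≥0∞) ^ (δ * |(X.level x : ℝ) - N|) * X.mass μ s p w x := by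
  have := hμ.countable_vertex X
  have hpq : 0 < p / q := div_pos hp hq
  obtain ⟨C₁, hC₁, h₁⟩ := hμ.cone_overlap X
  have hpos : ∃ ε : ℝ, 0 < ε ∧ (1 < p / q → ε = δ / (p / q - 1)) := by
    by_cases h : 1 < p / q
    · exact ⟨δ / (p / q - 1), div_pos hδ (by linarith), fun _ => rfl⟩
    · exact ⟨1, one_pos, fun h' => absurd h' h⟩
  obtain ⟨ε, hε, hεq⟩ := hpos
  obtain ⟨C₂, hC₂, h₂⟩ := tsum_two_rpow_abs hε
  refine ⟨1 + (C₁ * C₂) ^ |p / q - 1|, by finiteness, fun N w => ?_⟩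
  -- The summand 1 serves `p ≤ q`, the other one `p > q`; the absolute value keeps the constant
  -- finite in both cases.
  set K : ℝ≥0∞ := 1 + (C₁ * C₂) ^ |p / q - 1|
  have hK : K ≠ ∞ := by finiteness
  set θ : X.Vertex → ℝ≥0∞ := fun x => (2 : ℝ≥0∞) ^ (δ * |(X.level x : ℝ) - N|) with hθ
  set g : X.Vertex → ℝ≥0∞ := fun x => (2 : ℝ≥0∞) ^ ((X.level x : ℝ) * s) * w x with hg
  have hpt : ∀ ξ, (∑' x, (X.ball x).indicator (fun _ => g x ^ q) ξ) ^ (p / q) ≤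
      K * ∑' x, (X.ball x).indicator (fun _ => θ x * g x ^ p) ξ := by
    intro ξ
    have key := rpow_tsum_le_weighted hpq (fun x => (X.ball x).indicator (fun _ => g x ^ q) ξ) θ
      {x | ξ ∈ X.ball x} (K := K) (fun x hx => indicator_of_notMem (s := X.ball x) hx _)
      (fun x _ => two_rpow_ne_zero _) (fun x _ => two_rpow_ne_top _) ?_ ?_
    · refine key.trans (le_of_eq ?_)
      congr 2; ext x
      by_cases hx : ξ ∈ X.ball x
      · simp only [indicator_of_mem hx]
        rw [← ENNReal.rpow_mul, mul_div_cancel₀ _ hq.ne']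
      · simp [indicator_of_notMem hx, hpq]
    · intro _ x _
      refine one_le_mul_of_one_le_of_one_le le_self_add ?_
      calc (1 : ℝ≥0∞) = 2 ^ (0 : ℝ) := by simp
        _ ≤ _ := two_rpow_mono (by positivity)
    · intro h1
      refine le_trans ?_ (le_add_self)
      rw [abs_of_pos (by linarith : 0 < p / q - 1)]
      refine ENNReal.rpow_le_rpow ?_ (by linarith)
      rw [X.tsum_vertex]
      calc _ ≤ ∑' n : ℤ, C₁ * (2 : ℝ≥0∞) ^ (-ε * |(n : ℝ) - N|) := by
            refine ENNReal.tsum_le_tsum fun n => ?_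
            refine le_trans (ENNReal.tsum_le_tsum fun x => ?_)
              (le_trans ENNReal.tsum_mul_right.le (mul_le_mul_left (h₁ n ξ) _))
            by_cases hx : ξ ∈ X.ball ⟨n, x⟩
            · rw [indicator_of_mem hx, indicator_of_mem (show _ ∈ {x | ξ ∈ X.ball x} from hx),
                one_mul, hθ, ← ENNReal.rpow_mul, hεq h1]
              refine le_of_eq ?_
              congr 1
              change δ * |(n : ℝ) - N| * _ = _
              ring
            · rw [indicator_of_notMem (show _ ∉ {x | ξ ∈ X.ball x} from hx)]
              exact zero_le
        _ ≤ C₁ * C₂ := by rw [ENNReal.tsum_mul_left]; gcongr; exact h₂ N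
  unfold HyperbolicFilling.energy
  refine (lintegral_mono hpt).trans ?_
  rw [lintegral_const_mul' _ _ hK, lintegral_tsum fun x =>
    (measurable_const.indicator (X.measurableSet_ball x)).aemeasurable]
  refine le_of_eq ?_
  congr 2; ext x
  rw [lintegral_indicator_const (X.measurableSet_ball x), mul_assoc]
  rfl

/-- A single term of a cone sum is at most the whole sum, and each level contributes boundedly many
terms to a cone. -/
theorem mass_le_energy (hp : 0 < p) (hq : 0 < q) :
    ∃ C : ℝ≥0∞, C ≠ ∞ ∧ ∀ (m : ℤ) (w : X.Vertex → ℝ≥0∞),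
      ∑' x : X.net m, X.mass μ s p w ⟨m, x⟩ ≤ C * X.energy μ s p q w := by
  have := hμ.countable_net X
  have hpq : 0 < p / q := div_pos hp hq
  obtain ⟨C, hC, h⟩ := hμ.cone_overlap X
  refine ⟨C, hC, fun m w => ?_⟩
  set g : X.Vertex → ℝ≥0∞ := fun x => (2 : ℝ≥0∞) ^ ((X.level x : ℝ) * s) * w x with hg
  calc ∑' x : X.net m, X.mass μ s p w ⟨m, x⟩
      = ∑' x : X.net m, ∫⁻ ξ, (X.ball ⟨m, x⟩).indicator (fun _ => g ⟨m, x⟩ ^ p) ξ ∂μ := by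
        congr 1; ext x
        rw [lintegral_indicator_const (X.measurableSet_ball _)]
        rfl
    _ = ∫⁻ ξ, ∑' x : X.net m, (X.ball ⟨m, x⟩).indicator (fun _ => g ⟨m, x⟩ ^ p) ξ ∂μ :=
        (lintegral_tsum fun x =>
          (measurable_const.indicator (X.measurableSet_ball _)).aemeasurable).symm
    _ ≤ ∫⁻ ξ, C * (∑' x, (X.ball x).indicator (fun _ => g x ^ q) ξ) ^ (p / q) ∂μ := by
        refine lintegral_mono fun ξ => ?_
        refine le_trans (ENNReal.tsum_le_tsum fun x => ?_)
          (le_trans ENNReal.tsum_mul_right.le (mul_le_mul_left (h m ξ) _))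
        by_cases hx : ξ ∈ X.ball ⟨m, x⟩
        · rw [indicator_of_mem hx, indicator_of_mem hx, one_mul]
          calc g ⟨m, x⟩ ^ p = (g ⟨m, x⟩ ^ q) ^ (p / q) := by
                rw [← ENNReal.rpow_mul, mul_div_cancel₀ _ hq.ne']
            _ ≤ _ := by
                gcongr
                have := ENNReal.le_tsum (f := fun x => (X.ball x).indicator (fun _ => g x ^ q) ξ)
                  (⟨m, x⟩ : X.Vertex)
                rwa [indicator_of_mem hx] at this
        · rw [indicator_of_notMem hx]; exact zero_le
    _ = _ := lintegral_const_mul' _ _ hC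

/-- The degree of the graph is bounded: neighbors lie on three levels, and on each the overlap
estimate applies with 12 = 2 · 6, the scale of the neighbor being possibly half as large. -/
theorem derivNorm_le : ∃ C : ℝ≥0∞, C ≠ ∞ ∧ ∀ (u : X.Vertex → ℂ) (x : X.Vertex) (A : ℝ≥0∞),
    (∀ y, X.Adj x y → ‖u y - u x‖ₑ ≤ A) → X.derivNorm u x ≤ C * A := by
  classical
  obtain ⟨C, hC, h⟩ := hμ.overlap X 12
  refine ⟨(3 * C) ^ (1 / 2 : ℝ), by finiteness, fun u x A hA => ?_⟩
  have hcount : ∑' y : X.Vertex, (if X.Adj x y then (1 : ℝ≥0∞) else 0) ≤ 3 * C := by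
    rw [X.tsum_vertex, tsum_eq_sum (s := Finset.Icc (X.level x - 1) (X.level x + 1))]
    · refine (Finset.sum_le_card_nsmul _ _ C fun n _ => ?_).trans ?_
      · refine le_trans (ENNReal.tsum_le_tsum fun y => ?_) (h n (X.center x))
        split_ifs with h1 h2 h2
        · exact le_rfl
        · exact absurd (h1.dist_lt.trans_le (by
            have := h1.scale_le'
            change _ ≤ 12 * scale Z (X.level ⟨n, y⟩)
            linarith)) h2
        · exact zero_le
        · exact zero_le
      · rw [Int.card_Icc, nsmul_eq_mul]
        gcongr
        have : (X.level x + 1 + 1 - (X.level x - 1)).toNat = 3 := by omega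
        rw [this]; norm_num
    · intro n hn
      rw [ENNReal.tsum_eq_zero]
      intro y
      rw [if_neg]
      intro hadj
      have h1 : |X.level x - n| ≤ 1 := hadj.2.1
      have := abs_le.1 h1
      exact hn (Finset.mem_Icc.2 ⟨by omega, by omega⟩)
  unfold HyperbolicFilling.derivNorm
  calc (∑' y : {y : X.Vertex // X.Adj x y}, ‖u y.1 - u x‖ₑ ^ 2) ^ (1 / 2 : ℝ)
      ≤ (3 * C * A ^ 2) ^ (1 / 2 : ℝ) := by
        gcongr
        refine (tsum_subtype {y | X.Adj x y} (fun y => ‖u y - u x‖ₑ ^ 2)).trans_le ?_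
        refine le_trans (ENNReal.tsum_le_tsum fun y => ?_)
              (le_trans ENNReal.tsum_mul_right.le (mul_le_mul_left hcount _))
        by_cases hy : X.Adj x y
        · rw [indicator_of_mem (show y ∈ {y | X.Adj x y} from hy), if_pos hy, one_mul]
          gcongr
          exact hA y hy
        · rw [indicator_of_notMem (show y ∉ {y | X.Adj x y} from hy)]; exact zero_le
    _ = (3 * C) ^ (1 / 2 : ℝ) * A := by
        rw [ENNReal.mul_rpow_of_nonneg _ _ (by norm_num), ← ENNReal.rpow_natCast,
          ← ENNReal.rpow_mul]
        norm_num

theorem derivNorm_add_le : ∃ C : ℝ≥0∞, C ≠ ∞ ∧ ∀ (u v w : X.Vertex → ℂ),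
    (∀ x y, ‖u y - u x‖ₑ ≤ ‖v y - v x‖ₑ + ‖w y - w x‖ₑ) →
    ∀ x, X.derivNorm u x ≤ C * (X.derivNorm v x + X.derivNorm w x) := by
  obtain ⟨C, hC, h⟩ := hμ.derivNorm_le X
  refine ⟨C, hC, fun u v w huvw x => h u x _ fun y hy => (huvw x y).trans ?_⟩
  exact add_le_add (X.enorm_sub_le_derivNorm v hy) (X.enorm_sub_le_derivNorm w hy)

end IsDoublingMeasure

end Energy

/-! ### Coarse levels: averages of a function dominated by fine levels -/

section LowLevels

variable {Z : Type*} [MetricSpace Z] (X : HyperbolicFilling Z)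
variable [MeasurableSpace Z]

namespace HyperbolicFilling

/-- The integral of `G` over an enlargement of `B(y)`, divided by the measure of `B(y)`. -/
noncomputable def bigAvg (μ : Measure Z) (G : Z → ℝ≥0∞) (y : X.Vertex) : ℝ≥0∞ :=
  (∫⁻ ξ in Metric.ball (X.center y) (10 * scale Z (X.level y)), G ξ ∂μ) / μ (X.ball y)

/-- The function `G` is dominated by the sequence `a` on the levels from `n` on. -/
def DominatedFrom (μ : Measure Z) (n : ℤ) (a : X.Vertex → ℝ≥0∞) (G : Z → ℝ≥0∞) : Prop :=
  ∀ᵐ ξ ∂μ, G ξ ≤ ∑' x, (X.ball x).indicator (fun _ => X.restrict (n ≤ ·) a x) ξ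

/-- The contribution of the levels from `n` on, with geometrically decaying weights. -/
noncomputable def decay (μ : Measure Z) (s p δ : ℝ) (n : ℤ) (a : X.Vertex → ℝ≥0∞) : ℝ≥0∞ :=
  ∑' x, (2 : ℝ≥0∞) ^ (-δ * ((X.level x : ℝ) - n)) * X.mass μ s p (X.restrict (n ≤ ·) a) x

theorem mass_mono {μ : Measure Z} {s p : ℝ} (hp : 0 ≤ p) {v w : X.Vertex → ℝ≥0∞} {x : X.Vertex}
    (h : v x ≤ w x) : X.mass μ s p v x ≤ X.mass μ s p w x := by
  unfold mass
  gcongr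

theorem mass_const_mul {μ : Measure Z} {s p : ℝ} (hp : 0 ≤ p) (C : ℝ≥0∞) (w : X.Vertex → ℝ≥0∞)
    (x : X.Vertex) : X.mass μ s p (fun x => C * w x) x = C ^ p * X.mass μ s p w x := by
  unfold mass
  rw [mul_left_comm, ENNReal.mul_rpow_of_nonneg _ _ hp, mul_assoc]

theorem mass_eq {μ : Measure Z} {s p : ℝ} (hp : 0 ≤ p) (w : X.Vertex → ℝ≥0∞)
    (x : X.Vertex) : X.mass μ s p w x = 2 ^ ((X.level x : ℝ) * s * p) * (w x ^ p * μ (X.ball x)) := by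
  unfold mass
  rw [ENNReal.mul_rpow_of_nonneg _ _ hp, ← ENNReal.rpow_mul, mul_assoc]

theorem decay_const_mul {μ : Measure Z} {s p δ : ℝ} (hp : 0 ≤ p) (C : ℝ≥0∞) {n : ℤ}
    (w : X.Vertex → ℝ≥0∞) :
    X.decay μ s p δ n (fun x => C * w x) = C ^ p * X.decay μ s p δ n w := by
  unfold decay
  rw [← ENNReal.tsum_mul_left]
  congr 1; ext x
  rw [mul_left_comm, ← X.mass_const_mul hp]
  congr 3; ext x
  unfold restrict
  split_ifs <;> simp

end HyperbolicFilling

variable [BorelSpace Z] {μ : Measure Z} {s p q Q σ δ₁ : ℝ}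

namespace IsDoublingMeasure

variable (hμ : IsDoublingMeasure μ Q)
include hμ

theorem measure_ball_le_mass (K : ℝ) : ∃ C : ℝ≥0∞, C ≠ ∞ ∧ ∀ y : X.Vertex,
    μ (ball (X.center y) (K * scale Z (X.level y))) ≤ C * μ (X.ball y) := by
  obtain ⟨C, hC, h⟩ := hμ.ball_le (|K| + 1) 0
  refine ⟨C, hC, fun y => ?_⟩
  have hs := scale_pos (Z := Z) (X.level y)
  have h1 := h (X.center y) (X.center y) (X.level y) (X.level y)
    (by rw [dist_self]; positivity) (by simp)
  simp only [sub_self, zero_mul, ENNReal.rpow_zero, mul_one] at h1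
  calc _ ≤ μ (ball (X.center y) ((|K| + 1) * scale Z (X.level y))) := by
        gcongr; linarith [le_abs_self K]
    _ ≤ _ := h1
    _ ≤ _ := by gcongr; exact X.subset_ball y

theorem measure_ratio (K : ℝ) (hK : 2 ≤ K) (j : ℕ) : ∃ C : ℝ≥0∞, C ≠ ∞ ∧ ∀ x y : X.Vertex,
    dist (X.center x) (X.center y) < K * scale Z (X.level y) → X.level y ≤ X.level x + j →
    μ (X.ball y) ≤ C * 2 ^ (((X.level x : ℝ) - X.level y) * Q) * μ (X.ball x) := by
  obtain ⟨C, hC, h⟩ := hμ.ball_le K j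
  refine ⟨C, hC, fun x y hxy hl => ?_⟩
  have hs := scale_pos (Z := Z) (X.level y)
  calc μ (X.ball y) ≤ μ (ball (X.center y) (K * scale Z (X.level y))) := by
        refine measure_mono ((X.ball_subset y).trans (ball_subset_ball ?_))
        gcongr
    _ ≤ _ := h _ _ _ _ hxy hl
    _ ≤ _ := by gcongr; exact X.subset_ball x

theorem enorm_poisson_le (f : Z → ℂ) (y : X.Vertex) :
    ‖X.poisson μ f y‖ₑ ≤ (∫⁻ ξ in X.ball y, ‖f ξ‖ₑ ∂μ) / μ (X.ball y) := by
  unfold HyperbolicFilling.poisson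
  rw [setAverage_eq, enorm_smul, mul_comm, div_eq_mul_inv]
  gcongr
  · exact enorm_integral_le_lintegral_enorm _
  · rw [enorm_inv (by
      rw [Measure.real, ENNReal.toReal_ne_zero]
      exact ⟨hμ.measure_ne_zero X y, hμ.measure_ne_top X y⟩),
      Measure.real, Real.enorm_eq_ofReal ENNReal.toReal_nonneg,
      ENNReal.ofReal_toReal (hμ.measure_ne_top X y)]

theorem enorm_poisson_le_bigAvg (f : Z → ℂ) (y : X.Vertex) :
    ‖X.poisson μ f y‖ₑ ≤ X.bigAvg μ (fun ξ => ‖f ξ‖ₑ) y := by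
  refine (hμ.enorm_poisson_le X f y).trans ?_
  unfold HyperbolicFilling.bigAvg
  gcongr
  refine (X.ball_subset y).trans (ball_subset_ball ?_)
  have hs := scale_pos (Z := Z) (X.level y)
  gcongr; norm_num

theorem derivNorm_poisson_le : ∃ C : ℝ≥0∞, C ≠ ∞ ∧ ∀ (f : Z → ℂ) (y : X.Vertex),
    X.derivNorm (X.poisson μ f) y ≤ C * X.bigAvg μ (fun ξ => ‖f ξ‖ₑ) y := by
  obtain ⟨C₁, hC₁, h₁⟩ := hμ.derivNorm_le X
  obtain ⟨C₂, hC₂, h₂⟩ := hμ.measure_ratio X 12 (by norm_num) 1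
  refine ⟨C₁ * (C₂ * 2 ^ Q + 1), by finiteness [two_rpow_ne_top], fun f y => ?_⟩
  rw [mul_assoc]
  refine h₁ _ _ _ fun z hz => ?_
  rw [add_mul, one_mul]
  refine (enorm_sub_le).trans (add_le_add ?_ (hμ.enorm_poisson_le_bigAvg X f y))
  refine (hμ.enorm_poisson_le X f z).trans ?_
  have hlev := abs_le.1 hz.2.1
  have hzy : μ (X.ball y) ≤ C₂ * 2 ^ Q * μ (X.ball z) := by
    have hs := scale_pos (Z := Z) (X.level y)
    refine (h₂ z y (hz.dist_lt.trans (by linarith)) (by push_cast; omega)).trans ?_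
    gcongr
    · norm_num
    · have : ((X.level z : ℝ) - X.level y) ≤ 1 := by exact_mod_cast (by omega)
      nlinarith [hμ.exponent_pos]
  unfold HyperbolicFilling.bigAvg
  have h0 := hμ.measure_ne_zero X z
  have ht := hμ.measure_ne_top X z
  have h0' := hμ.measure_ne_zero X y
  have ht' := hμ.measure_ne_top X y
  calc (∫⁻ ξ in X.ball z, ‖f ξ‖ₑ ∂μ) / μ (X.ball z)
      ≤ (∫⁻ ξ in ball (X.center y) (10 * scale Z (X.level y)), ‖f ξ‖ₑ ∂μ) * (μ (X.ball z))⁻¹ := by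
        rw [div_eq_mul_inv]; gcongr; exact hz.ball_subset
    _ ≤ (∫⁻ ξ in ball (X.center y) (10 * scale Z (X.level y)), ‖f ξ‖ₑ ∂μ) *
        (C₂ * 2 ^ Q * (μ (X.ball y))⁻¹) := by
        gcongr
        rw [ENNReal.inv_le_iff_le_mul (fun _ => h0) (fun h => absurd h ht)]
        calc (1 : ℝ≥0∞) = μ (X.ball y) * (μ (X.ball y))⁻¹ := (ENNReal.mul_inv_cancel h0' ht').symm
          _ ≤ C₂ * 2 ^ Q * μ (X.ball z) * (μ (X.ball y))⁻¹ := by gcongr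
          _ = _ := by ring
    _ = _ := by rw [div_eq_mul_inv]; ring

/-- Integrate the domination term by term. A ball of level at least `n` has radius at most `2 * 2 ^
j` times the scale of `y`, so it meets the enlarged ball only if its center is near. -/
theorem bigAvg_le_tsum (j : ℕ) {n : ℤ} {a : X.Vertex → ℝ≥0∞} {G : Z → ℝ≥0∞}
    (hG : X.DominatedFrom μ n a G) {y : X.Vertex} (hy : X.level y ≤ n + j) :
    X.bigAvg μ G y ≤ ∑' x, (if dist (X.center x) (X.center y) <
      (10 + 2 * 2 ^ j) * scale Z (X.level y) then
      X.restrict (n ≤ ·) a x * (μ (X.ball x) / μ (X.ball y)) else 0) := by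
  have := hμ.countable_vertex X
  unfold HyperbolicFilling.bigAvg
  set B := ball (X.center y) (10 * scale Z (X.level y)) with hB
  calc (∫⁻ ξ in B, G ξ ∂μ) / μ (X.ball y)
      ≤ (∫⁻ ξ in B, ∑' x, (X.ball x).indicator (fun _ => X.restrict (n ≤ ·) a x) ξ ∂μ) /
        μ (X.ball y) := by
        gcongr ?_ / _
        exact lintegral_mono_ae (ae_restrict_of_ae hG)
    _ = ∑' x, X.restrict (n ≤ ·) a x * (μ (X.ball x ∩ B) / μ (X.ball y)) := by
        rw [lintegral_tsum fun x =>
          (measurable_const.indicator (X.measurableSet_ball _)).aemeasurable, div_eq_mul_inv,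
          ← ENNReal.tsum_mul_right]
        congr 1; ext x
        rw [lintegral_indicator_const (X.measurableSet_ball x),
          Measure.restrict_apply (X.measurableSet_ball x), mul_assoc, div_eq_mul_inv]
    _ ≤ _ := by
        refine ENNReal.tsum_le_tsum fun x => ?_
        split_ifs with h
        · gcongr; exact inter_subset_left
        · unfold HyperbolicFilling.restrict
          split_ifs with hx
          · have : X.ball x ∩ B = ∅ := by
              rw [← disjoint_iff_inter_eq_empty]
              refine Disjoint.mono_left (X.ball_subset x) (ball_disjoint_ball ?_)
              have := scale_le (Z := Z) (m := X.level x) (k := X.level y) (j := j) (by omega)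
              rw [zpow_natCast] at this
              linarith
            simp [this]
          · simp

/-- With ρ = μ(B(x))/μ(B(y)), apply the weighted inequality to the terms a(x)ρ. For p ≤ 1 doubling
bounds ρ^(1-p) from below by a multiple of 2^{-(|x|-|y|)Q(1-p)}, which σ compensates. For p > 1 the
dual weight is ρ times a geometric factor, and the ρ of one level have bounded sum by packing. -/
theorem bigAvg_rpow_le (hp : 0 < p) (hσ : 0 < σ) (hσQ : Q * (1 - p) ≤ σ) (j : ℕ) :
    ∃ C : ℝ≥0∞, C ≠ ∞ ∧ ∀ (n : ℤ) (a : X.Vertex → ℝ≥0∞) (G : Z → ℝ≥0∞) (y : X.Vertex),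
      X.DominatedFrom μ n a G → X.level y ≤ n + j →
      X.bigAvg μ G y ^ p * μ (X.ball y) ≤ C * ∑' x, (if dist (X.center x) (X.center y) <
        (10 + 2 * 2 ^ j) * scale Z (X.level y) then
        2 ^ (((X.level x : ℝ) - X.level y) * σ) * (X.restrict (n ≤ ·) a x ^ p * μ (X.ball x))
        else 0) := by
  set K : ℝ := 10 + 2 * 2 ^ j with hKdef
  have hK2 : 2 ≤ K := by
    have : (0 : ℝ) < 2 ^ j := by positivity
    linarith
  obtain ⟨C₁, hC₁, h₁⟩ := hμ.measure_ratio X K hK2 j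
  obtain ⟨C₂, hC₂, h₂⟩ := hμ.packing X
  obtain ⟨C₃, hC₃, h₃⟩ := hμ.measure_ball_le_mass X (K + 2 ^ j)
  obtain ⟨σ', hσ', hσ'p⟩ : ∃ ε : ℝ, 0 < ε ∧ (1 < p → ε = σ / (p - 1)) := by
    by_cases h : 1 < p
    · exact ⟨σ / (p - 1), div_pos hσ (by linarith), fun _ => rfl⟩
    · exact ⟨1, one_pos, fun h' => absurd h' h⟩
  obtain ⟨C₄, hC₄, h₄⟩ := tsum_two_rpow_abs hσ'
  set D₁ : ℝ≥0∞ := C₁ ^ |1 - p| * 2 ^ (j * σ) with hD₁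
  set D₂ : ℝ≥0∞ := (2 ^ (2 * j * σ') * (C₂ * C₃) * C₄) ^ |p - 1| with hD₂
  have hD₁t : D₁ ≠ ∞ := by finiteness [two_rpow_ne_top]
  have hD₂t : D₂ ≠ ∞ := by
    rw [hD₂]
    have := two_rpow_ne_top (2 * j * σ')
    finiteness
  refine ⟨D₁ + D₂, by finiteness, fun n a G y hG hy => ?_⟩
  have hy0 := hμ.measure_ne_zero X y
  have hyt := hμ.measure_ne_top X y
  set ρ : X.Vertex → ℝ≥0∞ := fun x => μ (X.ball x) / μ (X.ball y) with hρ
  have hρ0 : ∀ x, ρ x ≠ 0 := fun x => (ENNReal.div_pos (hμ.measure_ne_zero X x) hyt).ne'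
  have hρt : ∀ x, ρ x ≠ ∞ := fun x => ENNReal.div_ne_top (hμ.measure_ne_top X x) hy0
  set near : X.Vertex → Prop := fun x => dist (X.center x) (X.center y) < K * scale Z (X.level y)
    with hnear
  -- Chosen so that θ (a ρ)^p μ(B(y)) is the summand on the right-hand side.
  set θ : X.Vertex → ℝ≥0∞ := fun x => ρ x ^ (1 - p) * 2 ^ (((X.level x : ℝ) - X.level y) * σ)
    with hθ
  set c : X.Vertex → ℝ≥0∞ := fun x => if near x then X.restrict (n ≤ ·) a x * ρ x else 0 with hc
  set S : Set X.Vertex := {x | near x ∧ n ≤ X.level x} with hS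
  have key := rpow_tsum_le_weighted hp c θ S (K := D₁ + D₂) ?_ ?_ ?_ ?_ ?_
  · calc X.bigAvg μ G y ^ p * μ (X.ball y) ≤ (∑' x, c x) ^ p * μ (X.ball y) := by
          gcongr
          exact hμ.bigAvg_le_tsum X j hG hy
      _ ≤ (D₁ + D₂) * (∑' x, θ x * c x ^ p) * μ (X.ball y) := by gcongr
      _ = _ := by
          rw [mul_assoc, ← ENNReal.tsum_mul_right]
          congr 2; ext x
          simp only [hc, hθ]
          split_ifs with hx
          · rw [ENNReal.mul_rpow_of_nonneg _ _ hp.le]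
            have e1 : ρ x ^ (1 - p) * ρ x ^ p = ρ x := by
              rw [← ENNReal.rpow_add _ _ (hρ0 x) (hρt x)]; simp
            have e2 : ρ x * μ (X.ball y) = μ (X.ball x) := ENNReal.div_mul_cancel hy0 hyt
            calc _ = 2 ^ (((X.level x : ℝ) - X.level y) * σ) * (X.restrict (n ≤ ·) a x ^ p *
                  ((ρ x ^ (1 - p) * ρ x ^ p) * μ (X.ball y))) := by ring
              _ = _ := by rw [e1, e2]
          · simp [hp]
  · intro x hx
    simp only [hc]
    split_ifs with h
    · have : ¬ n ≤ X.level x := fun h' => hx ⟨h, h'⟩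
      simp [HyperbolicFilling.restrict, this]
    · rfl
  · intro x _
    exact mul_ne_zero (by simp [ENNReal.rpow_eq_zero_iff, hρ0, hρt]) (two_rpow_ne_zero _)
  · intro x _
    exact ENNReal.mul_ne_top (by simp [ENNReal.rpow_eq_top_iff, hρ0, hρt]) (two_rpow_ne_top _)
  · rintro hp1 x ⟨hx, hxn⟩
    have h1p : 0 ≤ 1 - p := by linarith
    have hj : (X.level y : ℝ) ≤ X.level x + j := by exact_mod_cast hy.trans (by omega)
    have hr : (1 : ℝ≥0∞) ≤ C₁ * 2 ^ (((X.level x : ℝ) - X.level y) * Q) * ρ x := by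
      rw [hρ]
      simp only
      rw [← mul_div_assoc, ENNReal.le_div_iff_mul_le (Or.inl hy0) (Or.inl hyt), one_mul]
      exact h₁ x y hx (by omega)
    calc (1 : ℝ≥0∞) ≤ (C₁ * 2 ^ (((X.level x : ℝ) - X.level y) * Q) * ρ x) ^ (1 - p) :=
          by
            simpa using ENNReal.rpow_le_rpow hr h1p
      _ = C₁ ^ |1 - p| * (2 ^ (((X.level x : ℝ) - X.level y) * Q * (1 - p))) * ρ x ^ (1 - p) := by
          rw [ENNReal.mul_rpow_of_nonneg _ _ h1p, ENNReal.mul_rpow_of_nonneg _ _ h1p,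
            abs_of_nonneg h1p, ← ENNReal.rpow_mul]
      _ ≤ C₁ ^ |1 - p| * (2 ^ (j * σ + ((X.level x : ℝ) - X.level y) * σ)) * ρ x ^ (1 - p) := by
          -- The level difference is at least `-j`; adding `j` makes it nonnegative, so that `Q * (1
          -- - p)` may be replaced by `σ`.
          refine mul_le_mul_left (mul_le_mul_right (two_rpow_mono ?_) _) _
          have hQ : 0 ≤ Q * (1 - p) := mul_nonneg hμ.exponent_pos.le h1p
          nlinarith
      _ = D₁ * θ x := by rw [two_rpow_add]; ring
      _ ≤ _ := by gcongr; exact le_self_add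
  · intro hp1
    have hp1' : 0 < p - 1 := by linarith
    refine le_trans ?_ le_add_self
    rw [hD₂, abs_of_pos hp1']
    refine ENNReal.rpow_le_rpow ?_ hp1'.le
    rw [X.tsum_vertex]
    calc _ ≤ ∑' m : ℤ, 2 ^ (2 * j * σ') * (C₂ * C₃) *
          (2 : ℝ≥0∞) ^ (-σ' * |(m : ℝ) - (X.level y : ℤ)|) := by
          refine ENNReal.tsum_le_tsum fun m => ?_
          by_cases hm : n ≤ m
          · have hj : (X.level y : ℝ) ≤ m + j := by exact_mod_cast hy.trans (by omega)
            have hsum : ∑' x : X.net m, (if dist (x : Z) (X.center y) < K * scale Z (X.level y) then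
                μ (X.ball ⟨m, x⟩) else 0) ≤ C₂ * C₃ * μ (X.ball y) := by
              refine (h₂ m _ _).trans ?_
              rw [mul_assoc]
              gcongr
              refine le_trans (measure_mono (ball_subset_ball ?_)) (h₃ y)
              have := scale_le (Z := Z) (m := m) (k := X.level y) (j := j) (by omega)
              rw [zpow_natCast] at this
              linarith
            calc _ ≤ ∑' x : X.net m, 2 ^ (2 * j * σ') *
                  (2 : ℝ≥0∞) ^ (-σ' * |(m : ℝ) - (X.level y : ℤ)|) * (μ (X.ball y))⁻¹ *
                  (if dist (x : Z) (X.center y) < K * scale Z (X.level y) then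
                    μ (X.ball ⟨m, x⟩) else 0) := by
                  refine ENNReal.tsum_le_tsum fun x => ?_
                  by_cases hx : (⟨m, x⟩ : X.Vertex) ∈ S
                  · rw [indicator_of_mem hx, if_pos (show dist (x : Z) (X.center y) <
                      K * scale Z (X.level y) from hx.1)]
                    have e1 : θ ⟨m, x⟩ ^ (-1 / (p - 1)) =
                        ρ ⟨m, x⟩ * 2 ^ (-((m : ℝ) - X.level y) * σ') := by
                      simp only [hθ]
                      rw [ENNReal.mul_rpow_of_ne_top
                        (by simp [ENNReal.rpow_eq_top_iff, hρ0, hρt]) (two_rpow_ne_top _),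
                        ← ENNReal.rpow_mul, ← ENNReal.rpow_mul, hσ'p hp1]
                      congr 1
                      · rw [show (1 - p) * (-1 / (p - 1)) = 1 by field_simp; ring,
                          ENNReal.rpow_one]
                      · congr 1
                        change ((m : ℝ) - _) * _ * _ = _
                        field_simp
                    rw [e1]
                    calc _ ≤ ρ ⟨m, x⟩ * 2 ^ (2 * j * σ' + -σ' * |(m : ℝ) - (X.level y : ℤ)|) := by
                          refine mul_le_mul_right (two_rpow_mono ?_) _
                          have : |(m : ℝ) - X.level y| ≤ (m - X.level y) + 2 * j := by
                            rw [abs_le]; constructor <;> linarith [Nat.cast_nonneg (α := ℝ) j]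
                          nlinarith
                      _ = _ := by
                          rw [two_rpow_add]; simp only [hρ]; rw [div_eq_mul_inv]; ring
                  · rw [indicator_of_notMem hx]; exact zero_le
              _ ≤ 2 ^ (2 * j * σ') *
                  (2 : ℝ≥0∞) ^ (-σ' * |(m : ℝ) - (X.level y : ℤ)|) * (μ (X.ball y))⁻¹ *
                  (C₂ * C₃ * μ (X.ball y)) := by
                  rw [ENNReal.tsum_mul_left]; gcongr
              _ = 2 ^ (2 * j * σ') * (C₂ * C₃) * 2 ^ (-σ' * |(m : ℝ) - (X.level y : ℤ)|) *
                  (μ (X.ball y) * (μ (X.ball y))⁻¹) := by ring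
              _ = _ := by rw [ENNReal.mul_inv_cancel hy0 hyt, mul_one]
          · rw [ENNReal.tsum_eq_zero.2]
            · exact zero_le
            · intro x
              exact indicator_of_notMem (fun h => hm h.2) _
      _ ≤ _ := by rw [ENNReal.tsum_mul_left]; gcongr; exact h₄ _

/-- Interchange the sums: each `x` is near boundedly many `y` of level `k`. The exponents combine as
ksp + (|x|-k)σ = |x|sp - (sp-σ)(|x|-n) - (sp-σ)(n-k). -/
theorem level_bigAvg_le (hp : 0 < p) (hσ : 0 < σ) (hσQ : Q * (1 - p) ≤ σ) (j : ℕ) :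
    ∃ C : ℝ≥0∞, C ≠ ∞ ∧ ∀ (n k : ℤ) (a : X.Vertex → ℝ≥0∞) (G : Z → ℝ≥0∞),
      X.DominatedFrom μ n a G → k ≤ n + j →
      ∑' y : X.net k, X.mass μ s p (X.bigAvg μ G) ⟨k, y⟩ ≤
        C * (2 ^ (-(s * p - σ) * ((n : ℝ) - k)) * X.decay μ s p (s * p - σ) n a) := by
  obtain ⟨C₁, hC₁, h₁⟩ := hμ.bigAvg_rpow_le X hp hσ hσQ j
  obtain ⟨C₂, hC₂, h₂⟩ := hμ.overlap X (10 + 2 * 2 ^ j)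
  refine ⟨C₁ * C₂, by finiteness, fun n k a G hG hk => ?_⟩
  set R : ℝ := (10 + 2 * 2 ^ j) * scale Z k with hR
  set g : X.Vertex → ℝ≥0∞ := fun x => 2 ^ ((k : ℝ) * s * p) *
    (2 ^ (((X.level x : ℝ) - k) * σ) * (X.restrict (n ≤ ·) a x ^ p * μ (X.ball x))) with hg
  calc ∑' y : X.net k, X.mass μ s p (X.bigAvg μ G) ⟨k, y⟩
      ≤ ∑' y : X.net k, C₁ * ∑' x, g x * (if dist (y : Z) (X.center x) < R then 1 else 0) := by
        refine ENNReal.tsum_le_tsum fun y => ?_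
        rw [X.mass_eq hp.le]
        refine (mul_le_mul_right (h₁ n a G ⟨k, y⟩ hG hk) _).trans (le_of_eq ?_)
        rw [mul_left_comm, ← ENNReal.tsum_mul_left]
        congr 2; ext x
        rw [dist_comm]
        change 2 ^ ((k : ℝ) * s * p) * (if dist (y : Z) (X.center x) < R then _ else 0) = _
        split_ifs
        · rw [mul_one]; rfl
        · simp
    _ = C₁ * ∑' x, g x * ∑' y : X.net k, (if dist (y : Z) (X.center x) < R then 1 else 0) := by
        rw [ENNReal.tsum_mul_left, ENNReal.tsum_comm]
        simp only [ENNReal.tsum_mul_left]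
    _ ≤ C₁ * ∑' x, g x * C₂ := by
        gcongr with x
        exact h₂ k (X.center x)
    _ = _ := by
        unfold HyperbolicFilling.decay
        rw [ENNReal.tsum_mul_right, mul_comm (∑' x, g x), mul_assoc,
          ← ENNReal.tsum_mul_left (a := (2 : ℝ≥0∞) ^ (-(s * p - σ) * ((n : ℝ) - k)))]
        refine congrArg (C₁ * ·) (congrArg (C₂ * ·) (tsum_congr fun x => ?_))
        rw [X.mass_eq hp.le, hg]
        simp only
        simp only [← mul_assoc, ← two_rpow_add]
        congr 3; ring

/-- Half of the decay rate sp - σ pays for the weight that `energy_le_mass` requires; the other half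
sums over the levels. -/
theorem low_bigAvg_le (hp : 0 < p) (hσ : 0 < σ) (hσQ : Q * (1 - p) ≤ σ) (hσs : σ < s * p)
    (hδ : 0 ≤ δ₁) (hδσ : δ₁ ≤ (s * p - σ) / 2) (j : ℕ) :
    ∃ C : ℝ≥0∞, C ≠ ∞ ∧ ∀ (n : ℤ) (a : X.Vertex → ℝ≥0∞) (G : Z → ℝ≥0∞),
      X.DominatedFrom μ n a G →
      ∑' y, (2 : ℝ≥0∞) ^ (δ₁ * |(X.level y : ℝ) - n|) *
        X.mass μ s p (X.restrict (· < n + j) (X.bigAvg μ G)) y ≤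
        C * X.decay μ s p (s * p - σ) n a := by
  obtain ⟨C₁, hC₁, h₁⟩ := hμ.level_bigAvg_le X (s := s) hp hσ hσQ j
  set δ := s * p - σ with hδdef
  have hδp : 0 < δ := by rw [hδdef]; linarith
  obtain ⟨C₂, hC₂, h₂⟩ := tsum_two_rpow_abs (half_pos hδp)
  refine ⟨C₁ * 2 ^ (2 * j * δ) * C₂, by finiteness [two_rpow_ne_top (2 * j * δ)],
    fun n a G hG => ?_⟩
  rw [X.tsum_vertex]
  set D := X.decay μ s p δ n a with hD
  calc _ ≤ ∑' k : ℤ, C₁ * 2 ^ (2 * j * δ) * D * (2 : ℝ≥0∞) ^ (-(δ / 2) * |(k : ℝ) - n|) := by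
        refine ENNReal.tsum_le_tsum fun k => ?_
        by_cases hk : k < n + j
        · have hk' : (k : ℝ) ≤ n + j := by exact_mod_cast hk.le
          calc _ ≤ ∑' y : X.net k, (2 : ℝ≥0∞) ^ (δ₁ * |(k : ℝ) - n|) *
                X.mass μ s p (X.bigAvg μ G) ⟨k, y⟩ := by
                refine ENNReal.tsum_le_tsum fun y => ?_
                change (2 : ℝ≥0∞) ^ (δ₁ * |(k : ℝ) - n|) * _ ≤ _
                gcongr
                exact X.mass_mono hp.le (X.restrict_le _ _ _)
            _ ≤ (2 : ℝ≥0∞) ^ (δ₁ * |(k : ℝ) - n|) *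
                (C₁ * (2 ^ (-δ * ((n : ℝ) - k)) * D)) := by
                rw [ENNReal.tsum_mul_left]
                gcongr
                exact h₁ n k a G hG hk.le
            _ = C₁ * D * 2 ^ (δ₁ * |(k : ℝ) - n| + -δ * ((n : ℝ) - k)) := by
                rw [two_rpow_add]; ring
            _ ≤ C₁ * D * 2 ^ (2 * j * δ + -(δ / 2) * |(k : ℝ) - n|) := by
                refine mul_le_mul_right (two_rpow_mono ?_) _
                have h1 : |(k : ℝ) - n| ≤ (n - k) + 2 * j := by
                  rw [abs_le]; constructor <;> linarith [Nat.cast_nonneg (α := ℝ) j]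
                nlinarith [abs_nonneg ((k : ℝ) - n)]
            _ = _ := by rw [two_rpow_add]; ring
        · rw [ENNReal.tsum_eq_zero.2]
          · exact zero_le
          · intro y
            have : ¬ X.level ⟨k, y⟩ < n + j := hk
            simp [HyperbolicFilling.mass, HyperbolicFilling.restrict, this, hp]
    _ ≤ _ := by
        rw [ENNReal.tsum_mul_left]
        calc _ ≤ C₁ * 2 ^ (2 * j * δ) * D * C₂ := by gcongr; exact h₂ n
          _ = _ := by ring

/-- The energy of the levels below `n + j` of a function that is dominated from level `n` on. -/
theorem energy_low_le (hp : 0 < p) (hq : 0 < q) (hσ : 0 < σ) (hσQ : Q * (1 - p) ≤ σ)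
    (hσs : σ < s * p) (j : ℕ) :
    ∃ C : ℝ≥0∞, C ≠ ∞ ∧ ∀ (n : ℤ) (a : X.Vertex → ℝ≥0∞) (f : Z → ℂ),
      X.DominatedFrom μ n a (fun ξ => ‖f ξ‖ₑ) →
      X.energy μ s p q (X.restrict (· < n + j) (X.derivNorm (X.poisson μ f))) ≤
        C * X.decay μ s p (s * p - σ) n a := by
  have hδ : 0 < (s * p - σ) / 2 := by linarith
  obtain ⟨C₁, hC₁, h₁⟩ := hμ.derivNorm_poisson_le X
  obtain ⟨C₂, hC₂, h₂⟩ := hμ.energy_le_mass X (s := s) hp hq hδ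
  obtain ⟨C₃, hC₃, h₃⟩ := hμ.low_bigAvg_le X hp hσ hσQ hσs hδ.le le_rfl j
  refine ⟨C₁ ^ p * (C₂ * C₃), by finiteness, fun n a f hf => ?_⟩
  calc X.energy μ s p q (X.restrict (· < n + j) (X.derivNorm (X.poisson μ f)))
      ≤ X.energy μ s p q (fun x => C₁ * X.restrict (· < n + j) (X.bigAvg μ fun ξ => ‖f ξ‖ₑ) x) := by
        refine X.energy_mono hp hq fun x => ?_
        unfold HyperbolicFilling.restrict
        split_ifs
        · exact h₁ f x
        · exact zero_le
    _ = C₁ ^ p * X.energy μ s p q (X.restrict (· < n + j) (X.bigAvg μ fun ξ => ‖f ξ‖ₑ)) :=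
        X.energy_const_mul hp hq hC₁ _
    _ ≤ C₁ ^ p * (C₂ * (C₃ * X.decay μ s p (s * p - σ) n a)) := by
        gcongr
        refine (h₂ n _).trans ?_
        gcongr
        exact h₃ n a _ hf
    _ = _ := by ring

end IsDoublingMeasure

end LowLevels

/-! ### Fine levels: functions that are Lipschitz at scale n -/

section HighLevels

variable {Z : Type*} [MetricSpace Z] (X : HyperbolicFilling Z)
variable [MeasurableSpace Z]

namespace HyperbolicFilling

/-- The function `f` is Lipschitz at the scale of level `n`, with constants given by `a`. -/
def LipschitzAtLevel (n : ℤ) (a : X.Vertex → ℝ≥0∞) (f : Z → ℂ) : Prop :=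
  ∀ (x : X.net n) (ξ η : Z), dist ξ x < scale Z n / 2 → dist ξ η < scale Z n / 2 →
    ‖f ξ - f η‖ₑ ≤ ENNReal.ofReal (dist ξ η / scale Z n) * a ⟨n, x⟩

theorem level_mass_le_decay {μ : Measure Z} {s p δ : ℝ} (n : ℤ) (a : X.Vertex → ℝ≥0∞) :
    ∑' x : X.net n, X.mass μ s p a ⟨n, x⟩ ≤ X.decay μ s p δ n a := by
  unfold decay
  rw [X.tsum_vertex]
  refine le_trans (le_of_eq ?_) (ENNReal.le_tsum n)
  refine tsum_congr fun x => ?_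
  change _ = (2 : ℝ≥0∞) ^ (-δ * ((n : ℝ) - n)) * _
  simp [mass, restrict, level]

end HyperbolicFilling

variable [BorelSpace Z] {μ : Measure Z} {s p q Q σ δ : ℝ}

theorem IsLocInt.integrableOn_ball {f : Z → ℂ} (hf : IsLocInt μ f) (x : X.Vertex) :
    IntegrableOn f (X.ball x) μ :=
  hf.2 _ (X.isBounded_ball x) (X.measurableSet_ball x)

theorem IsLocInt.sub {f g : Z → ℂ} (hf : IsLocInt μ f) (hg : IsLocInt μ g) :
    IsLocInt μ (f - g) :=
  ⟨hf.1.sub hg.1, fun A hA hm => (hf.2 A hA hm).sub (hg.2 A hA hm)⟩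

theorem poisson_sub {f g : Z → ℂ} (hf : IsLocInt μ f) (hg : IsLocInt μ g) (x : X.Vertex) :
    X.poisson μ (f - g) x = X.poisson μ f x - X.poisson μ g x := by
  unfold HyperbolicFilling.poisson
  simp only [setAverage_eq, Pi.sub_apply]
  rw [integral_sub (hf.integrableOn_ball X x) (hg.integrableOn_ball X x), smul_sub]

namespace IsDoublingMeasure

variable (hμ : IsDoublingMeasure μ Q)
include hμ

theorem isLocInt_const (c : ℂ) : IsLocInt μ (fun _ : Z => c) := by
  refine ⟨aestronglyMeasurable_const, fun A hA _ => integrableOn_const ?_⟩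
  rcases A.eq_empty_or_nonempty with rfl | ⟨z, -⟩
  · simp
  · obtain ⟨R, hR⟩ := hA.subset_ball z
    refine ((measure_mono (hR.trans (ball_subset_ball (le_max_left R 1)))).trans_lt
      (hμ.ball_lt_top z _ (lt_max_of_lt_right one_pos))).ne

theorem poisson_const (c : ℂ) (x : X.Vertex) : X.poisson μ (fun _ => c) x = c := by
  unfold HyperbolicFilling.poisson
  exact setAverage_const (hμ.measure_ne_zero X x) (hμ.measure_ne_top X x) c

theorem enorm_poisson_sub_le {f : Z → ℂ} (hf : IsLocInt μ f) (c : ℂ) (x : X.Vertex) :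
    ‖X.poisson μ f x - c‖ₑ ≤ (∫⁻ ξ in X.ball x, ‖f ξ - c‖ₑ ∂μ) / μ (X.ball x) := by
  have := hμ.enorm_poisson_le X (f - fun _ => c) x
  rwa [poisson_sub X hf (hμ.isLocInt_const c), hμ.poisson_const X] at this

theorem enorm_poisson_sub_le_of_forall {f : Z → ℂ} (hf : IsLocInt μ f) (c : ℂ) {x : X.Vertex}
    {A : ℝ≥0∞} (hA : ∀ ξ ∈ X.ball x, ‖f ξ - c‖ₑ ≤ A) : ‖X.poisson μ f x - c‖ₑ ≤ A := by
  refine (hμ.enorm_poisson_sub_le X hf c x).trans (ENNReal.div_le_of_le_mul ?_)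
  rw [← setLIntegral_const]
  exact setLIntegral_mono' (X.measurableSet_ball x) hA

/-- The averages over `B(y)` and over its neighbors are all compared with the value of `f` at the
center of `y`; the Lipschitz bound over distances of order 2^{-|y|} gives the gain 2^{n-|y|}. -/
theorem derivNorm_poisson_high_le : ∃ C : ℝ≥0∞, C ≠ ∞ ∧
    ∀ (n : ℤ) (a : X.Vertex → ℝ≥0∞) (f : Z → ℂ) (y : X.Vertex) (x : X.net n),
      IsLocInt μ f → X.LipschitzAtLevel n a f → n + 5 ≤ X.level y →
      dist (X.center y) x < scale Z n / 2 →
      X.derivNorm (X.poisson μ f) y ≤ C * (2 ^ ((n : ℝ) - X.level y) * a ⟨n, x⟩) := by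
  obtain ⟨C, hC, h⟩ := hμ.derivNorm_le X
  refine ⟨C * 20, by finiteness, fun n a f y x hf hL hy hx => ?_⟩
  set A : ℝ≥0∞ := 10 * (2 ^ ((n : ℝ) - X.level y) * a ⟨n, x⟩) with hA
  have hsn := scale_pos (Z := Z) n
  have hsy := scale_pos (Z := Z) (X.level y)
  -- This is why five levels are skipped: 10/32 < 1/2, so the tenfold ball stays within the range of
  -- the Lipschitz condition.
  have hsc : scale Z (X.level y) ≤ 1 / 32 * scale Z n := by
    have := scale_le (Z := Z) (m := X.level y) (k := n) (j := -5) (by omega)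
    norm_num at this
    linarith
  have hpt : ∀ ξ ∈ ball (X.center y) (10 * scale Z (X.level y)), ‖f ξ - f (X.center y)‖ₑ ≤ A := by
    intro ξ hξ
    rw [mem_ball, dist_comm] at hξ
    rw [← enorm_neg, neg_sub]
    refine (hL x _ ξ hx (by linarith)).trans ?_
    rw [hA, ← mul_assoc]
    gcongr
    calc ENNReal.ofReal (dist (X.center y) ξ / scale Z n)
        ≤ ENNReal.ofReal (10 * (2 : ℝ) ^ ((n : ℝ) - X.level y)) := by
          apply ENNReal.ofReal_le_ofReal
          rw [div_le_iff₀ hsn]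
          have := scale_eq (Z := Z) n (X.level y)
          rw [← Real.rpow_intCast, Int.cast_sub] at this
          rw [mul_assoc, ← this]
          exact hξ.le
      _ = _ := by
          rw [ENNReal.ofReal_mul (by norm_num), ← ENNReal.ofReal_rpow_of_pos two_pos]
          simp
  have hself : ‖X.poisson μ f y - f (X.center y)‖ₑ ≤ A :=
    hμ.enorm_poisson_sub_le_of_forall X hf _ fun ξ hξ => hpt ξ
      (ball_subset_ball (by linarith) (X.ball_subset y hξ))
  have hAA : C * 20 * (2 ^ ((n : ℝ) - X.level y) * a ⟨n, x⟩) = C * (A + A) := by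
    rw [hA]; ring
  rw [hAA]
  refine h _ y _ fun z hz => ?_
  rw [← sub_sub_sub_cancel_right _ _ (f (X.center y))]
  refine enorm_sub_le.trans (add_le_add ?_ hself)
  exact hμ.enorm_poisson_sub_le_of_forall X hf _ fun ξ hξ => hpt ξ (hz.ball_subset hξ)

/-- The energy of the levels from `n + 5` on of a function that is Lipschitz at the scale of
level `n`. -/
theorem energy_high_le (hp : 0 < p) (hq : 0 < q) (hs1 : s < 1) :
    ∃ C : ℝ≥0∞, C ≠ ∞ ∧ ∀ (n : ℤ) (a : X.Vertex → ℝ≥0∞) (f : Z → ℂ),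
      X.IsFull n → IsLocInt μ f → X.LipschitzAtLevel n a f →
      X.energy μ s p q (X.restrict (n + 5 ≤ ·) (X.derivNorm (X.poisson μ f))) ≤
        C * X.decay μ s p δ n a := by
  have hε : 0 < (1 - s) * p / 2 := by have : 0 < 1 - s := by linarith
                                      positivity
  -- The mass of level `k` decays like 2^{-2ε(k-n)}; one ε is spent on the Besov weight, the other
  -- on the sum over `k`.
  set ε := (1 - s) * p / 2 with hεdef
  obtain ⟨C₁, hC₁, h₁⟩ := hμ.derivNorm_poisson_high_le X
  obtain ⟨C₂, hC₂, h₂⟩ := hμ.energy_le_mass X (s := s) hp hq hε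
  obtain ⟨C₃, hC₃, h₃⟩ := hμ.packing X
  obtain ⟨C₄, hC₄, h₄⟩ := hμ.measure_ball_le_mass X 2
  obtain ⟨C₅, hC₅, h₅⟩ := tsum_two_rpow_abs hε
  refine ⟨C₂ * (C₁ ^ p * (C₃ * C₄) * C₅), by finiteness, fun n a f hn hf hL => ?_⟩
  refine (h₂ n _).trans ?_
  rw [mul_assoc]
  gcongr
  set D := X.decay μ s p δ n a with hD
  set w := X.derivNorm (X.poisson μ f) with hw
  have hlevel : ∀ k : ℤ, n + 5 ≤ k → ∑' y : X.net k, X.mass μ s p w ⟨k, y⟩ ≤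
      C₁ ^ p * (C₃ * C₄) * D * 2 ^ (-(2 * ε) * ((k : ℝ) - n)) := by
    intro k hk
    have hsk : scale Z k ≤ scale Z n := scale_anti (by omega)
    have hsn := scale_pos (Z := Z) n
    -- One nearby `x` of level `n` suffices, but summing over all of them allows the sums to be
    -- interchanged and the `y` near each `x` to be packed.
    have hpt : ∀ y : X.net k, X.mass μ s p w ⟨k, y⟩ ≤ C₁ ^ p * 2 ^ (-(2 * ε) * ((k : ℝ) - n)) *
        ∑' x : X.net n, 2 ^ ((n : ℝ) * s * p) * a ⟨n, x⟩ ^ p *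
          (if dist (y : Z) x < scale Z n / 2 then μ (X.ball ⟨k, y⟩) else 0) := by
      intro y
      obtain ⟨x, hx⟩ := X.exists_dist_lt hn (y : Z)
      rw [X.mass_eq hp.le]
      calc _ ≤ 2 ^ ((k : ℝ) * s * p) * ((C₁ * (2 ^ ((n : ℝ) - k) * a ⟨n, x⟩)) ^ p *
            μ (X.ball ⟨k, y⟩)) := by
            refine mul_le_mul_right (mul_le_mul_left (ENNReal.rpow_le_rpow ?_ hp.le) _) _
            exact h₁ n a f ⟨k, y⟩ x hf hL hk hx
        _ = C₁ ^ p * 2 ^ (-(2 * ε) * ((k : ℝ) - n)) *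
            (2 ^ ((n : ℝ) * s * p) * a ⟨n, x⟩ ^ p * μ (X.ball ⟨k, y⟩)) := by
            rw [ENNReal.mul_rpow_of_nonneg _ _ hp.le, ENNReal.mul_rpow_of_nonneg _ _ hp.le,
              ← ENNReal.rpow_mul]
            have e : (2 : ℝ≥0∞) ^ ((k : ℝ) * s * p) * 2 ^ (((n : ℝ) - k) * p) =
                2 ^ (-(2 * ε) * ((k : ℝ) - n)) * 2 ^ ((n : ℝ) * s * p) := by
              rw [← two_rpow_add, ← two_rpow_add, hεdef]
              congr 1; ring
            calc _ = (2 : ℝ≥0∞) ^ ((k : ℝ) * s * p) * 2 ^ (((n : ℝ) - k) * p) *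
                  (C₁ ^ p * a ⟨n, x⟩ ^ p * μ (X.ball ⟨k, y⟩)) := by ring
              _ = _ := by rw [e]; ring
        _ ≤ _ := by
            gcongr
            refine le_trans (le_of_eq ?_) (ENNReal.le_tsum x)
            rw [if_pos hx]
    calc _ ≤ _ := ENNReal.tsum_le_tsum hpt
      _ = C₁ ^ p * 2 ^ (-(2 * ε) * ((k : ℝ) - n)) *
          ∑' x : X.net n, 2 ^ ((n : ℝ) * s * p) * a ⟨n, x⟩ ^ p *
          ∑' y : X.net k, (if dist (y : Z) x < scale Z n / 2 then μ (X.ball ⟨k, y⟩) else 0) := by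
          rw [ENNReal.tsum_mul_left, ENNReal.tsum_comm]
          simp only [ENNReal.tsum_mul_left]
      _ ≤ C₁ ^ p * 2 ^ (-(2 * ε) * ((k : ℝ) - n)) *
          ∑' x : X.net n, 2 ^ ((n : ℝ) * s * p) * a ⟨n, x⟩ ^ p *
            (C₃ * C₄ * μ (X.ball ⟨n, x⟩)) := by
          refine mul_le_mul_right (ENNReal.tsum_le_tsum fun x => mul_le_mul_right ?_ _) _
          refine (h₃ k _ _).trans ?_
          rw [mul_assoc]
          refine mul_le_mul_right (le_trans (measure_mono (ball_subset_ball ?_)) (h₄ ⟨n, x⟩)) _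
          change _ ≤ 2 * scale Z n
          linarith
      _ = C₁ ^ p * 2 ^ (-(2 * ε) * ((k : ℝ) - n)) *
          ((C₃ * C₄) * ∑' x : X.net n, X.mass μ s p a ⟨n, x⟩) := by
          rw [← ENNReal.tsum_mul_left (a := C₃ * C₄)]
          refine congrArg _ (tsum_congr fun x => ?_)
          rw [X.mass_eq hp.le]
          change 2 ^ ((n : ℝ) * s * p) * _ * _ = _ * (2 ^ ((n : ℝ) * s * p) * _)
          ring
      _ ≤ C₁ ^ p * 2 ^ (-(2 * ε) * ((k : ℝ) - n)) * ((C₃ * C₄) * D) := by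
          gcongr
          exact X.level_mass_le_decay n a
      _ = _ := by ring
  rw [X.tsum_vertex]
  calc _ ≤ ∑' k : ℤ, C₁ ^ p * (C₃ * C₄) * D * (2 : ℝ≥0∞) ^ (-ε * |(k : ℝ) - n|) := by
        refine ENNReal.tsum_le_tsum fun k => ?_
        by_cases hk : n + 5 ≤ k
        · have hk' : (n : ℝ) + 5 ≤ k := by exact_mod_cast hk
          calc _ ≤ ∑' y : X.net k, (2 : ℝ≥0∞) ^ (ε * |(k : ℝ) - n|) *
                X.mass μ s p w ⟨k, y⟩ := by
                refine ENNReal.tsum_le_tsum fun y => ?_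
                refine mul_le_mul_right (X.mass_mono hp.le (X.restrict_le _ _ _)) _
            _ ≤ (2 : ℝ≥0∞) ^ (ε * |(k : ℝ) - n|) *
                (C₁ ^ p * (C₃ * C₄) * D * 2 ^ (-(2 * ε) * ((k : ℝ) - n))) := by
                rw [ENNReal.tsum_mul_left]
                gcongr
                exact hlevel k hk
            _ = C₁ ^ p * (C₃ * C₄) * D *
                2 ^ (ε * |(k : ℝ) - n| + -(2 * ε) * ((k : ℝ) - n)) := by
                rw [two_rpow_add]; ring
            _ = _ := by
                rw [abs_of_nonneg (by linarith : 0 ≤ (k : ℝ) - n)]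
                congr 2; ring
        · rw [ENNReal.tsum_eq_zero.2]
          · exact zero_le
          · intro y
            have : ¬ n + 5 ≤ X.level ⟨k, y⟩ := hk
            simp [HyperbolicFilling.mass, HyperbolicFilling.restrict, this, hp]
    _ ≤ _ := by
        rw [ENNReal.tsum_mul_left]
        calc _ ≤ C₁ ^ p * (C₃ * C₄) * D * C₅ := by gcongr; exact h₅ n
          _ = _ := by ring

/-- The energy of a function that is dominated from level `n` on and Lipschitz at the scale of
level `n`. -/
theorem energy_le_decay (hp : 0 < p) (hq : 0 < q) (hs1 : s < 1) (hσ : 0 < σ)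
    (hσQ : Q * (1 - p) ≤ σ) (hσs : σ < s * p) :
    ∃ C : ℝ≥0∞, C ≠ ∞ ∧ ∀ (n : ℤ) (a : X.Vertex → ℝ≥0∞) (f : Z → ℂ),
      X.IsFull n → IsLocInt μ f → X.DominatedFrom μ n a (fun ξ => ‖f ξ‖ₑ) →
      X.LipschitzAtLevel n a f →
      X.energy μ s p q (X.derivNorm (X.poisson μ f)) ≤ C * X.decay μ s p (s * p - σ) n a := by
  have := hμ.countable_vertex X
  obtain ⟨C₁, hC₁, h₁⟩ := X.energy_add_le (μ := μ) (s := s) hp hq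
  obtain ⟨C₂, hC₂, h₂⟩ := hμ.energy_low_le X hp hq hσ hσQ hσs 5
  obtain ⟨C₃, hC₃, h₃⟩ := hμ.energy_high_le X (δ := s * p - σ) hp hq hs1
  refine ⟨C₁ * (C₂ + C₃), by finiteness, fun n a f hn hf hdom hL => ?_⟩
  set w := X.derivNorm (X.poisson μ f) with hw
  calc X.energy μ s p q w
      ≤ X.energy μ s p q (fun x => X.restrict (· < n + 5) w x + X.restrict (n + 5 ≤ ·) w x) := by
        refine X.energy_mono hp hq fun x => ?_
        unfold HyperbolicFilling.restrict
        rcases lt_or_ge (X.level x) (n + 5) with h | h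
        · rw [if_pos h]; exact le_self_add
        · rw [if_pos h]; exact le_add_self
    _ ≤ C₁ * (X.energy μ s p q (X.restrict (· < n + 5) w) +
        X.energy μ s p q (X.restrict (n + 5 ≤ ·) w)) := h₁ _ _
    _ ≤ C₁ * (C₂ * X.decay μ s p (s * p - σ) n a + C₃ * X.decay μ s p (s * p - σ) n a) := by
        gcongr
        · exact h₂ n a f hdom
        · exact h₃ n a f hn hf hL
    _ = _ := by ring

end IsDoublingMeasure

end HighLevels

/-! ### Interpolation by tent functions -/

section Interpolation

variable {Z : Type*} [MetricSpace Z] (X : HyperbolicFilling Z)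

/-- The tent function of height one about `x` at the scale of level `n`. -/
noncomputable def tent (n : ℤ) (x ξ : Z) : ℝ := max 0 (1 - dist ξ x / scale Z n)

theorem tent_nonneg (n : ℤ) (x ξ : Z) : 0 ≤ tent n x ξ := le_max_left _ _

theorem tent_eq_zero {n : ℤ} {x ξ : Z} (h : ¬ dist x ξ < scale Z n) : tent n x ξ = 0 := by
  rw [dist_comm, not_lt] at h
  refine max_eq_left ?_
  rw [sub_nonpos, le_div_iff₀ (scale_pos n)]
  linarith

theorem half_le_tent {n : ℤ} {x ξ : Z} (h : dist ξ x < scale Z n / 2) : 1 / 2 ≤ tent n x ξ := by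
  refine le_trans ?_ (le_max_right _ _)
  have : dist ξ x / scale Z n ≤ 1 / 2 := by
    rw [div_le_iff₀ (scale_pos n)]; linarith
  linarith

theorem abs_tent_sub_le (n : ℤ) (x ξ η : Z) :
    |tent n x ξ - tent n x η| ≤ dist ξ η / scale Z n := by
  unfold tent
  rw [max_comm 0, max_comm 0]
  refine (abs_max_sub_max_le_abs _ _ 0).trans ?_
  rw [sub_sub_sub_cancel_left, ← sub_div, abs_div, abs_of_pos (scale_pos n)]
  gcongr
  · exact (scale_pos n).le
  · rw [dist_comm ξ η]; exact abs_dist_sub_le _ _ _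

namespace HyperbolicFilling

/-- The function that interpolates the values `c` at the centers of the vertices of level `n`. -/
noncomputable def interp (n : ℤ) (c : X.net n → ℂ) (ξ : Z) : ℂ :=
  (∑' x : X.net n, (tent n (x : Z) ξ : ℂ) * c x) / ((∑' x : X.net n, tent n (x : Z) ξ : ℝ) : ℂ)

/-- The freedom in `F` lets two points be treated with one common finite set. -/
theorem interp_eq {n : ℤ} (c : X.net n → ℂ) {ξ : Z} {F : Finset (X.net n)}
    (hF : ∀ x : X.net n, dist (x : Z) ξ < scale Z n → x ∈ F) :
    X.interp n c ξ = (∑ x ∈ F, (tent n (x : Z) ξ : ℂ) * c x) / ((∑ x ∈ F, tent n (x : Z) ξ : ℝ) : ℂ) := by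
  unfold interp
  have h0 : ∀ x ∉ F, tent n (x : Z) ξ = 0 := fun x hx => tent_eq_zero fun h => hx (hF x h)
  rw [tsum_eq_sum (s := F) fun x hx => by rw [h0 x hx]; simp, tsum_eq_sum (s := F) h0]

theorem half_le_sum_tent {n : ℤ} (hn : X.IsFull n) {ξ : Z} {F : Finset (X.net n)}
    (hF : ∀ x : X.net n, dist (x : Z) ξ < scale Z n → x ∈ F) :
    1 / 2 ≤ ∑ x ∈ F, tent n (x : Z) ξ := by
  obtain ⟨x, hx⟩ := X.exists_dist_lt hn ξ
  refine (half_le_tent hx).trans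
    (Finset.single_le_sum (f := fun x : X.net n => tent n (x : Z) ξ)
      (fun x _ => tent_nonneg _ _ _) (hF x ?_))
  rw [dist_comm]; linarith [scale_pos (Z := Z) n]

theorem interp_sub_eq {n : ℤ} (hn : X.IsFull n) (c : X.net n → ℂ) (z : ℂ) {ξ : Z}
    {F : Finset (X.net n)} (hF : ∀ x : X.net n, dist (x : Z) ξ < scale Z n → x ∈ F) :
    X.interp n c ξ - z =
      (∑ x ∈ F, (tent n (x : Z) ξ : ℂ) * (c x - z)) / ((∑ x ∈ F, tent n (x : Z) ξ : ℝ) : ℂ) := by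
  have hW : ((∑ x ∈ F, tent n (x : Z) ξ : ℝ) : ℂ) ≠ 0 := by
    have := X.half_le_sum_tent hn hF
    exact_mod_cast (by linarith : (0 : ℝ) < _).ne'
  rw [X.interp_eq c hF, eq_div_iff hW, sub_mul, div_mul_cancel₀ _ hW]
  simp only [mul_sub, Finset.sum_sub_distrib, ← Finset.sum_mul]
  push_cast
  ring

theorem norm_sum_tent_le {n : ℤ} (c : X.net n → ℂ) (z : ℂ) {ξ : Z} (F : Finset (X.net n)) {A : ℝ}
    (hA : ∀ x : X.net n, dist (x : Z) ξ < scale Z n → ‖c x - z‖ ≤ A) :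
    ‖∑ x ∈ F, (tent n (x : Z) ξ : ℂ) * (c x - z)‖ ≤ (∑ x ∈ F, tent n (x : Z) ξ) * A := by
  rw [Finset.sum_mul]
  refine norm_sum_le_of_le _ fun x _ => ?_
  rw [norm_mul, Complex.norm_real, Real.norm_eq_abs, abs_of_nonneg (tent_nonneg _ _ _)]
  by_cases hx : dist (x : Z) ξ < scale Z n
  · exact mul_le_mul_of_nonneg_left (hA x hx) (tent_nonneg _ _ _)
  · rw [tent_eq_zero hx]; simp

end HyperbolicFilling

variable [MeasurableSpace Z] [BorelSpace Z] {μ : Measure Z} {s p q Q σ δ : ℝ}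

theorem HyperbolicFilling.decay_restrict_level_le (hp : 0 < p) (n : ℤ) (w : X.Vertex → ℝ≥0∞) :
    X.decay μ s p δ n (X.restrict (· = n) w) ≤ ∑' y : X.net n, X.mass μ s p w ⟨n, y⟩ := by
  unfold HyperbolicFilling.decay
  rw [X.tsum_vertex, tsum_eq_single n]
  · refine ENNReal.tsum_le_tsum fun y => ?_
    change (2 : ℝ≥0∞) ^ (-δ * ((n : ℝ) - n)) * _ ≤ _
    rw [sub_self, mul_zero, ENNReal.rpow_zero, one_mul]
    exact X.mass_mono hp.le ((X.restrict_le _ _ _).trans (X.restrict_le _ _ _))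
  · intro m hm
    rw [ENNReal.tsum_eq_zero]
    intro y
    have : ¬ X.level ⟨m, y⟩ = n := hm
    simp [HyperbolicFilling.mass, HyperbolicFilling.restrict, this, hp]

namespace IsDoublingMeasure

variable (hμ : IsDoublingMeasure μ Q)
include hμ

theorem exists_card_le (K : ℝ) : ∃ M : ℕ, ∀ (n : ℤ) (ξ : Z) (F : Finset (X.net n)),
    (∀ x ∈ F, dist (x : Z) ξ < K * scale Z n) → F.card ≤ M := by
  obtain ⟨C, hC, h⟩ := hμ.overlap X K
  obtain ⟨M, hM⟩ := ENNReal.exists_nat_gt hC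
  refine ⟨M, fun n ξ F hF => ?_⟩
  have : (F.card : ℝ≥0∞) ≤ C := by
    refine le_trans (le_of_eq ?_) ((ENNReal.sum_le_tsum F).trans (h n ξ))
    rw [Finset.sum_congr rfl fun x hx => if_pos (hF x hx)]
    simp
  exact_mod_cast (this.trans hM.le)

theorem exists_near_finset (n : ℤ) (ξ : Z) (R : ℝ) :
    ∃ F : Finset (X.net n), ∀ x : X.net n, x ∈ F ↔ dist (x : Z) ξ < R :=
  ⟨(hμ.finite_near X n ξ R).toFinset, fun x => by simp⟩

/-- The interpolation is a convex combination of the values at nearby centers, the denominator being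
at least 1/2 by maximality of the net. -/
theorem norm_interp_sub_le {n : ℤ} (hn : X.IsFull n) (c : X.net n → ℂ) (z : ℂ) {ξ : Z} {A : ℝ}
    (hA : ∀ x : X.net n, dist (x : Z) ξ < scale Z n → ‖c x - z‖ ≤ A) :
    ‖X.interp n c ξ - z‖ ≤ A := by
  obtain ⟨F, hF⟩ := hμ.exists_near_finset X n ξ (scale Z n)
  have hF' := fun x => (hF x).2
  have hW := X.half_le_sum_tent hn hF'
  rw [X.interp_sub_eq hn c z hF', norm_div, Complex.norm_real, Real.norm_eq_abs,
    abs_of_nonneg (by linarith), div_le_iff₀ (by linarith), mul_comm]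
  exact X.norm_sum_tent_le c z F hA

theorem enorm_interp_sub_le {n : ℤ} (hn : X.IsFull n) (c : X.net n → ℂ) (z : ℂ) {ξ : Z} {A : ℝ≥0∞}
    (hA : ∀ x : X.net n, dist (x : Z) ξ < scale Z n → ‖c x - z‖ₑ ≤ A) :
    ‖X.interp n c ξ - z‖ₑ ≤ A := by
  by_cases hAt : A = ∞
  · rw [hAt]; exact le_top
  · lift A to NNReal using hAt
    have h : ‖X.interp n c ξ - z‖ ≤ A := hμ.norm_interp_sub_le X hn c z fun x hx => by
      have := hA x hx
      rw [enorm_le_coe] at this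
      exact this
    rw [enorm_le_coe]
    exact h

/-- A quotient rule. Only the oscillation of the values about some `z` enters, because the
normalized tents sum to 1. -/
theorem norm_interp_sub_interp_le : ∃ C : ℝ, 0 < C ∧ ∀ (n : ℤ) (c : X.net n → ℂ) (z : ℂ)
    (ξ η : Z) (A : ℝ), X.IsFull n → 0 ≤ A →
    (∀ x : X.net n, dist (x : Z) ξ < scale Z n ∨ dist (x : Z) η < scale Z n → ‖c x - z‖ ≤ A) →
    ‖X.interp n c ξ - X.interp n c η‖ ≤ C * (dist ξ η / scale Z n) * A := by
  classical
  obtain ⟨M, hM⟩ := hμ.exists_card_le X 1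
  -- `4 * M` each from the variation of the numerator and of the denominator; the 1 only makes the
  -- constant positive.
  refine ⟨8 * M + 1, by positivity, fun n c z ξ η A hn hA0 hA => ?_⟩
  obtain ⟨F₁, hF₁⟩ := hμ.exists_near_finset X n ξ (scale Z n)
  obtain ⟨F₂, hF₂⟩ := hμ.exists_near_finset X n η (scale Z n)
  set F := F₁ ∪ F₂ with hF
  have hcard : (F.card : ℝ) ≤ 2 * M := by
    have h1 := hM n ξ F₁ fun x hx => by simpa using (hF₁ x).1 hx
    have h2 := hM n η F₂ fun x hx => by simpa using (hF₂ x).1 hx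
    exact_mod_cast (Finset.card_union_le F₁ F₂).trans (by omega)
  have hmem : ∀ x ∈ F, dist (x : Z) ξ < scale Z n ∨ dist (x : Z) η < scale Z n := fun x hx => by
    rcases Finset.mem_union.1 hx with h | h
    · exact Or.inl ((hF₁ x).1 h)
    · exact Or.inr ((hF₂ x).1 h)
  have hξ : ∀ x : X.net n, dist (x : Z) ξ < scale Z n → x ∈ F :=
    fun x hx => Finset.mem_union_left _ ((hF₁ x).2 hx)
  have hη : ∀ x : X.net n, dist (x : Z) η < scale Z n → x ∈ F :=
    fun x hx => Finset.mem_union_right _ ((hF₂ x).2 hx)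
  set d := dist ξ η / scale Z n with hd
  have hd0 : 0 ≤ d := div_nonneg dist_nonneg (scale_pos n).le
  set W₁ := ∑ x ∈ F, tent n (x : Z) ξ with hW₁
  set W₂ := ∑ x ∈ F, tent n (x : Z) η with hW₂
  set N₁ := ∑ x ∈ F, (tent n (x : Z) ξ : ℂ) * (c x - z) with hN₁
  set N₂ := ∑ x ∈ F, (tent n (x : Z) η : ℂ) * (c x - z) with hN₂
  have hW₁h : 1 / 2 ≤ W₁ := X.half_le_sum_tent hn hξ
  have hW₂h : 1 / 2 ≤ W₂ := X.half_le_sum_tent hn hη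
  have hWW : |W₂ - W₁| ≤ 2 * M * d := by
    rw [hW₁, hW₂, ← Finset.sum_sub_distrib]
    refine (Finset.abs_sum_le_sum_abs _ _).trans ((Finset.sum_le_card_nsmul _ _ d fun x _ => ?_).trans ?_)
    · rw [abs_sub_comm]; exact abs_tent_sub_le _ _ _ _
    · rw [nsmul_eq_mul]; gcongr
  have hNN : ‖N₁ - N₂‖ ≤ 2 * M * d * A := by
    rw [hN₁, hN₂, ← Finset.sum_sub_distrib]
    refine (norm_sum_le_of_le (f := fun x : X.net n => (tent n (x : Z) ξ : ℂ) * (c x - z) -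
      (tent n (x : Z) η : ℂ) * (c x - z)) (n := fun _ => d * A) F fun x hx => ?_).trans ?_
    · rw [← sub_mul, norm_mul, ← Complex.ofReal_sub, Complex.norm_real, Real.norm_eq_abs]
      exact mul_le_mul (abs_tent_sub_le _ _ _ _) (hA x (hmem x hx)) (norm_nonneg _) hd0
    · rw [Finset.sum_const, nsmul_eq_mul, ← mul_assoc]; gcongr
  have hN₂W : ‖N₂‖ ≤ W₂ * A := X.norm_sum_tent_le c z F fun x hx => hA x (Or.inr hx)
  have e : X.interp n c ξ - X.interp n c η = (N₁ - N₂) / (W₁ : ℂ) +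
      N₂ / (W₂ : ℂ) * (((W₂ - W₁ : ℝ) : ℂ) / (W₁ : ℂ)) := by
    have aux : ∀ (a b : ℂ) {u v : ℝ}, 1 / 2 ≤ u → 1 / 2 ≤ v → a / (u : ℂ) - b / (v : ℂ) =
        (a - b) / (u : ℂ) + b / (v : ℂ) * (((v - u : ℝ) : ℂ) / (u : ℂ)) := by
      intro a b u v hu hv
      have h1 : (u : ℂ) ≠ 0 := by exact_mod_cast (by linarith : (0 : ℝ) < u).ne'
      have h2 : (v : ℂ) ≠ 0 := by exact_mod_cast (by linarith : (0 : ℝ) < v).ne'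
      push_cast
      field_simp
      ring
    rw [← sub_sub_sub_cancel_right _ _ z, X.interp_sub_eq hn c z hξ, X.interp_sub_eq hn c z hη]
    exact aux N₁ N₂ hW₁h hW₂h
  rw [e]
  have hW₁' : |W₁| = W₁ := abs_of_nonneg (by linarith)
  have hW₂' : |W₂| = W₂ := abs_of_nonneg (by linarith)
  have t1 : ‖(N₁ - N₂) / (W₁ : ℂ)‖ ≤ 4 * M * d * A := by
    rw [norm_div, Complex.norm_real, Real.norm_eq_abs, hW₁', div_le_iff₀ (by linarith)]
    have : 0 ≤ M * d * A := by positivity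
    nlinarith
  have t2 : ‖N₂ / (W₂ : ℂ)‖ ≤ A := by
    rw [norm_div, Complex.norm_real, Real.norm_eq_abs, hW₂', div_le_iff₀ (by linarith)]
    linarith
  have t3 : ‖((W₂ - W₁ : ℝ) : ℂ) / (W₁ : ℂ)‖ ≤ 4 * M * d := by
    rw [norm_div, Complex.norm_real, Complex.norm_real, Real.norm_eq_abs, Real.norm_eq_abs, hW₁',
      div_le_iff₀ (by linarith)]
    have : 0 ≤ M * d := by positivity
    nlinarith
  refine (norm_add_le _ _).trans ?_
  rw [norm_mul]
  have t4 := mul_le_mul t2 t3 (norm_nonneg _) hA0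
  have : 0 ≤ d * A := by positivity
  nlinarith

theorem enorm_interp_sub_interp_le : ∃ C : ℝ≥0∞, C ≠ ∞ ∧ ∀ (n : ℤ) (c : X.net n → ℂ) (z : ℂ)
    (ξ η : Z) (A : ℝ≥0∞), X.IsFull n →
    (∀ x : X.net n, dist (x : Z) ξ < scale Z n ∨ dist (x : Z) η < scale Z n → ‖c x - z‖ₑ ≤ A) →
    ‖X.interp n c ξ - X.interp n c η‖ₑ ≤ ENNReal.ofReal (dist ξ η / scale Z n) * (C * A) := by
  obtain ⟨C, hC, h⟩ := hμ.norm_interp_sub_interp_le X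
  refine ⟨ENNReal.ofReal C, ENNReal.ofReal_ne_top, fun n c z ξ η A hn hA => ?_⟩
  rcases eq_or_ne ξ η with rfl | hne
  · simp
  have hd : 0 < dist ξ η / scale Z n := div_pos (dist_pos.2 hne) (scale_pos n)
  by_cases hAt : A = ∞
  · rw [hAt, ENNReal.mul_top (by simpa using hC), ENNReal.mul_top (by simpa using hd)]
    exact le_top
  · have h' := h n c z ξ η A.toReal hn ENNReal.toReal_nonneg fun x hx => by
      have := ENNReal.toReal_mono hAt (hA x hx)
      simpa using this
    rw [← ofReal_norm]
    refine (ENNReal.ofReal_le_ofReal h').trans (le_of_eq ?_)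
    rw [ENNReal.ofReal_mul (by positivity), ENNReal.ofReal_mul hC.le, ENNReal.ofReal_toReal hAt]
    ring

theorem interp_sub_interp {n : ℤ} (c c' : X.net n → ℂ) :
    X.interp n c - X.interp n c' = X.interp n (c - c') := by
  ext ξ
  obtain ⟨F, hF⟩ := hμ.exists_near_finset X n ξ (scale Z n)
  have hF' := fun x => (hF x).2
  rw [Pi.sub_apply, X.interp_eq c hF', X.interp_eq c' hF', X.interp_eq (c - c') hF', ← sub_div,
    ← Finset.sum_sub_distrib]
  simp [mul_sub]

theorem exists_bound_near (n : ℤ) (c : X.net n → ℂ) (ξ : Z) (R : ℝ) :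
    ∃ A : ℝ, 0 ≤ A ∧ ∀ x : X.net n, dist (x : Z) ξ < R → ‖c x‖ ≤ A := by
  obtain ⟨F, hF⟩ := hμ.exists_near_finset X n ξ R
  refine ⟨∑ x ∈ F, ‖c x‖, by positivity, fun x hx => ?_⟩
  exact Finset.single_le_sum (f := fun x => ‖c x‖) (fun _ _ => norm_nonneg _) ((hF x).2 hx)

theorem continuous_interp {n : ℤ} (hn : X.IsFull n) (c : X.net n → ℂ) :
    Continuous (X.interp n c) := by
  obtain ⟨C, hC, h⟩ := hμ.norm_interp_sub_interp_le X
  refine continuous_iff_continuousAt.2 fun ξ => ?_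
  obtain ⟨A, hA0, hA⟩ := hμ.exists_bound_near X n c ξ (2 * scale Z n)
  refine continuousAt_of_locally_lipschitz (scale_pos (Z := Z) n) (C * A / scale Z n) fun η hη => ?_
  rw [dist_eq_norm]
  refine (h n c 0 η ξ A hn hA0 fun x hx => ?_).trans (le_of_eq (by ring))
  rw [sub_zero]
  refine hA x ?_
  have := scale_pos (Z := Z) n
  rcases hx with hx | hx
  · linarith [dist_triangle (x : Z) η ξ]
  · linarith

theorem isLocInt_of_continuous [SecondCountableTopology Z] {f : Z → ℂ} (hf : Continuous f)
    (hb : ∀ (o : Z) (R : ℝ), ∃ A : ℝ, ∀ ξ ∈ ball o R, ‖f ξ‖ ≤ A) : IsLocInt μ f := by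
  refine ⟨hf.aestronglyMeasurable, fun A hA hm => ?_⟩
  rcases A.eq_empty_or_nonempty with rfl | ⟨o, -⟩
  · simp
  obtain ⟨R, hR⟩ := hA.subset_ball o
  have hR' : A ⊆ ball o (max R 1) := hR.trans (ball_subset_ball (le_max_left _ _))
  obtain ⟨B, hB⟩ := hb o (max R 1)
  refine Measure.integrableOn_of_bounded (M := B)
    ((measure_mono hR').trans_lt (hμ.ball_lt_top _ _ (lt_max_of_lt_right one_pos))).ne
    hf.aestronglyMeasurable ?_
  filter_upwards [ae_restrict_mem hm] with ξ hξ using hB ξ (hR' hξ)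

theorem isLocInt_interp {n : ℤ} (hn : X.IsFull n) (c : X.net n → ℂ) :
    IsLocInt μ (X.interp n c) := by
  have := hμ.secondCountable X
  refine hμ.isLocInt_of_continuous (hμ.continuous_interp X hn c) fun o R => ?_
  obtain ⟨A, hA0, hA⟩ := hμ.exists_bound_near X n c o (R + scale Z n)
  refine ⟨A, fun ξ hξ => ?_⟩
  rw [mem_ball] at hξ
  have := hμ.norm_interp_sub_le X hn c 0 (ξ := ξ) (A := A) fun x hx => by
    rw [sub_zero]
    exact hA x (by linarith [dist_triangle (x : Z) ξ o])
  simpa using this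

/-- Finitely many coefficients are bounded, which makes the local Lipschitz constants uniform; the
support lies in the union of finitely many balls. -/
theorem interp_mem_lipBounded {n : ℤ} (hn : X.IsFull n) (c : X.net n → ℂ) (F : Finset (X.net n))
    (hc : ∀ x ∉ F, c x = 0) : X.interp n c ∈ lipBounded Z := by
  obtain ⟨C, hC, h⟩ := hμ.norm_interp_sub_interp_le X
  have hA : ∀ x, ‖c x‖ ≤ ∑ x ∈ F, ‖c x‖ := fun x => by
    by_cases hx : x ∈ F
    · exact Finset.single_le_sum (f := fun x => ‖c x‖) (fun _ _ => norm_nonneg _) hx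
    · rw [hc x hx, norm_zero]; positivity
  have hA0 : 0 ≤ ∑ x ∈ F, ‖c x‖ := by positivity
  refine ⟨⟨(C * (∑ x ∈ F, ‖c x‖) / scale Z n).toNNReal, LipschitzWith.of_dist_le_mul fun ξ η => ?_⟩, ?_⟩
  · rw [dist_eq_norm, Real.coe_toNNReal _ (by have := scale_pos (Z := Z) n; positivity)]
    refine (h n c 0 ξ η _ hn hA0 fun x _ => ?_).trans (le_of_eq (by ring))
    rw [sub_zero]; exact hA x
  · refine Bornology.IsBounded.subset ((Bornology.isBounded_biUnion F.finite_toSet).2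
      (fun x _ => isBounded_ball (x := (x : Z)) (r := scale Z n))) fun ξ hξ => ?_
    by_contra hne
    refine hξ (norm_le_zero_iff.1 ?_)
    have := hμ.norm_interp_sub_le X hn c 0 (ξ := ξ) (A := 0) fun x hx => by
      by_cases hxF : x ∈ F
      · exfalso
        refine hne (mem_iUnion₂.2 ⟨x, hxF, ?_⟩)
        rwa [mem_ball, dist_comm]
      · rw [hc x hxF]; simp
    simpa using this

/-- Interpolation of the Poisson extension is Lipschitz at the scale of its level. -/
theorem lipschitzAtLevel_interp_poisson : ∃ C : ℝ≥0∞, C ≠ ∞ ∧ ∀ (n : ℤ) (u : X.Vertex → ℂ),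
    X.IsFull n → X.LipschitzAtLevel n (fun x => C * X.derivNorm u x)
      (X.interp n fun x => u ⟨n, x⟩) := by
  obtain ⟨C, hC, h⟩ := hμ.enorm_interp_sub_interp_le X
  refine ⟨C, hC, fun n u hn x ξ η hξ hη => ?_⟩
  have hs := scale_pos (Z := Z) n
  refine h n _ (u ⟨n, x⟩) ξ η _ hn fun x' hx' => ?_
  rcases eq_or_ne x' x with rfl | hne
  · simp
  -- A center whose tent is active at `ξ` or `η` belongs to a neighbor of `x`, since both points lie
  -- in `B(x)`.
  refine X.enorm_sub_le_derivNorm u ⟨fun h => hne ?_, by simp [HyperbolicFilling.level], ?_⟩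
  · exact (eq_of_heq (Sigma.mk.inj h).2).symm
  · have hξx : ξ ∈ X.ball ⟨n, x⟩ := X.subset_ball ⟨n, x⟩ (by
      change dist ξ x < scale Z n; linarith)
    have hηx : η ∈ X.ball ⟨n, x⟩ := X.subset_ball ⟨n, x⟩ (by
      change dist η x < scale Z n
      linarith [dist_triangle_left η (x : Z) ξ])
    rcases hx' with hx' | hx'
    · exact ⟨ξ, hξx, X.subset_ball ⟨n, x'⟩ (by change dist ξ x' < scale Z n; rwa [dist_comm])⟩
    · exact ⟨η, hηx, X.subset_ball ⟨n, x'⟩ (by change dist η x' < scale Z n; rwa [dist_comm])⟩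

/-- The energy of an interpolation is bounded by the sum of the masses of its values. -/
theorem energy_interp_le (hp : 0 < p) (hq : 0 < q) (hs1 : s < 1) (hσ : 0 < σ)
    (hσQ : Q * (1 - p) ≤ σ) (hσs : σ < s * p) :
    ∃ C : ℝ≥0∞, C ≠ ∞ ∧ ∀ (n : ℤ) (c : X.net n → ℂ), X.IsFull n →
      X.energy μ s p q (X.derivNorm (X.poisson μ (X.interp n c))) ≤
        C * (2 ^ ((n : ℝ) * s * p) * ∑' x : X.net n, ‖c x‖ₑ ^ p * μ (X.ball ⟨n, x⟩)) := by
  obtain ⟨C₁, hC₁, h₁⟩ := hμ.energy_le_decay X (q := q) hp hq hs1 hσ hσQ hσs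
  obtain ⟨C₂, hC₂, h₂⟩ := hμ.enorm_interp_sub_interp_le X
  obtain ⟨C₃, hC₃, h₃⟩ := hμ.overlap X 2
  obtain ⟨C₄, hC₄, h₄⟩ := hμ.packing X
  obtain ⟨C₅, hC₅, h₅⟩ := hμ.measure_ball_le_mass X 3
  set K : ℝ≥0∞ := 1 + C₃ ^ |p - 1| with hK
  have hKt : K ≠ ∞ := by finiteness
  refine ⟨C₁ * ((1 + C₂) ^ p * (K * (C₄ * C₅))), by finiteness, fun n c hn => ?_⟩
  set near : X.Vertex → ℝ≥0∞ := fun y =>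
    ∑' x : X.net n, (if dist (x : Z) (X.center y) < 2 * scale Z n then ‖c x‖ₑ else 0) with hnear
  -- One sequence serves both hypotheses of `energy_le_decay`: 1 gives the domination, `C₂` the
  -- Lipschitz condition. It lives on level `n` alone, so `decay` reduces to a sum over that level.
  set a : X.Vertex → ℝ≥0∞ := fun y => (1 + C₂) * X.restrict (· = n) near y with ha
  have hs := scale_pos (Z := Z) n
  have hle : ∀ (x : X.net n) (y : X.net n), dist (x : Z) y < 2 * scale Z n →
      ‖c x‖ₑ ≤ near ⟨n, y⟩ := by
    intro x y hxy
    refine le_trans (le_of_eq ?_) (ENNReal.le_tsum x)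
    rw [if_pos (show dist (x : Z) (X.center ⟨n, y⟩) < _ from hxy)]
  have hrn : ∀ y : X.net n, X.restrict (· = n) near ⟨n, y⟩ = near ⟨n, y⟩ := fun y =>
    if_pos rfl
  have hdom : X.DominatedFrom μ n a fun ξ => ‖X.interp n c ξ‖ₑ := by
    refine Eventually.of_forall fun ξ => ?_
    have := hμ.enorm_interp_sub_le X hn c 0 (ξ := ξ)
      (A := ∑' x, (X.ball x).indicator (fun _ => X.restrict (n ≤ ·) a x) ξ) fun x hx => by
        refine le_trans ?_ (ENNReal.le_tsum ⟨n, x⟩)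
        have hmem : ξ ∈ X.ball ⟨n, x⟩ := X.subset_ball ⟨n, x⟩ (by
          change dist ξ x < scale Z n; rwa [dist_comm])
        rw [indicator_of_mem hmem, sub_zero]
        have e : X.restrict (n ≤ ·) a ⟨n, x⟩ = a ⟨n, x⟩ := if_pos le_rfl
        rw [e, ha]
        simp only
        rw [hrn, add_mul, one_mul]
        exact (hle x x (by rw [dist_self]; positivity)).trans le_self_add
    simpa using this
  have hL : X.LipschitzAtLevel n a (X.interp n c) := by
    intro x ξ η hξ hη
    refine (h₂ n c 0 ξ η (near ⟨n, x⟩) hn fun x' hx' => ?_).trans ?_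
    · rw [sub_zero]
      refine hle x' x ?_
      rcases hx' with hx' | hx'
      · linarith [dist_triangle (x' : Z) ξ x]
      · linarith [dist_triangle (x' : Z) η x, dist_triangle_left η (x : Z) ξ]
    · rw [ha]
      simp only
      rw [hrn]
      gcongr
      exact le_add_self
  refine (h₁ n a _ hn (hμ.isLocInt_interp X hn c) hdom hL).trans ?_
  rw [X.decay_const_mul hp.le, mul_assoc C₁, mul_assoc ((1 + C₂) ^ p)]
  gcongr
  refine (X.decay_restrict_level_le hp n near).trans ?_
  have hpow : ∀ y : X.net n, near ⟨n, y⟩ ^ p ≤ K * ∑' x : X.net n, ‖c x‖ₑ ^ p *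
      (if dist (y : Z) x < 2 * scale Z n then 1 else 0) := by
    intro y
    have key := rpow_tsum_le_weighted hp
      (fun x : X.net n => if dist (x : Z) (X.center ⟨n, y⟩) < 2 * scale Z n then ‖c x‖ₑ else 0)
      (fun _ => 1) {x | dist (x : Z) y < 2 * scale Z n} (K := K) (fun x hx => if_neg hx)
      (fun _ _ => one_ne_zero) (fun _ _ => ENNReal.one_ne_top)
      (fun _ _ _ => by rw [mul_one]; exact le_self_add) (fun h1 => by
        refine le_trans ?_ le_add_self
        rw [abs_of_pos (by linarith)]
        refine ENNReal.rpow_le_rpow (le_trans (ENNReal.tsum_le_tsum fun x => ?_) (h₃ n y))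
          (by linarith)
        by_cases hx : dist (x : Z) y < 2 * scale Z n
        · rw [if_pos hx, indicator_of_mem (by exact hx)]; simp
        · rw [if_neg hx, indicator_of_notMem (by exact hx)])
    refine key.trans (le_of_eq ?_)
    refine congrArg _ (tsum_congr fun x => ?_)
    rw [one_mul, dist_comm (y : Z)]
    change (if dist (x : Z) y < 2 * scale Z n then ‖c x‖ₑ else 0) ^ p = _
    split_ifs <;> simp [hp]
  calc ∑' y : X.net n, X.mass μ s p near ⟨n, y⟩
      ≤ ∑' y : X.net n, 2 ^ ((n : ℝ) * s * p) * ((K * ∑' x : X.net n, ‖c x‖ₑ ^ p *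
          (if dist (y : Z) x < 2 * scale Z n then 1 else 0)) * μ (X.ball ⟨n, y⟩)) := by
        refine ENNReal.tsum_le_tsum fun y => ?_
        rw [X.mass_eq hp.le]
        exact mul_le_mul_right (mul_le_mul_left (hpow y) _) _
    _ = 2 ^ ((n : ℝ) * s * p) * (K * ∑' x : X.net n, ‖c x‖ₑ ^ p * ∑' y : X.net n,
          (if dist (y : Z) x < 2 * scale Z n then μ (X.ball ⟨n, y⟩) else 0)) := by
        rw [ENNReal.tsum_mul_left]
        simp only [mul_assoc K]
        rw [ENNReal.tsum_mul_left]
        simp only [← ENNReal.tsum_mul_left, ← ENNReal.tsum_mul_right]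
        rw [ENNReal.tsum_comm]
        simp [mul_assoc]
    _ ≤ 2 ^ ((n : ℝ) * s * p) * (K * ∑' x : X.net n, ‖c x‖ₑ ^ p *
          (C₄ * C₅ * μ (X.ball ⟨n, x⟩))) := by
        refine mul_le_mul_right (mul_le_mul_right (ENNReal.tsum_le_tsum fun x =>
          mul_le_mul_right ?_ _) _) _
        refine (h₄ n _ _).trans ?_
        rw [mul_assoc]
        refine mul_le_mul_right (le_trans (measure_mono (ball_subset_ball ?_)) (h₅ ⟨n, x⟩)) _
        change _ ≤ 3 * scale Z n
        linarith
    _ = _ := by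
        simp only [mul_left_comm _ (C₄ * C₅)]
        rw [ENNReal.tsum_mul_left]
        ring

end IsDoublingMeasure

end Interpolation

/-! ### Approximation of f by its interpolations -/

section Approximation

variable {Z : Type*} [MetricSpace Z] (X : HyperbolicFilling Z)
variable [MeasurableSpace Z] [BorelSpace Z] {μ : Measure Z} {s p q Q σ δ : ℝ}

namespace IsDoublingMeasure

variable (hμ : IsDoublingMeasure μ Q)
include hμ

/-- Interpolation of the Poisson extension of `f` converges to `f` almost everywhere. -/
theorem ae_tendsto_interp_poisson {f : Z → ℂ} (hf : IsLocInt μ f) {n : ℤ} (hn : X.IsFull n) :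
    ∀ᵐ ξ ∂μ, Tendsto (fun j : ℕ => X.interp (n + j) (fun x => X.poisson μ f ⟨n + j, x⟩) ξ)
      atTop (𝓝 (f ξ)) := by
  have := hμ.secondCountable X
  have := hμ.isUnifLocDoublingMeasure
  have := hμ.isLocallyFiniteMeasure
  have hloc : LocallyIntegrable f μ := fun ξ =>
    ⟨ball ξ 1, ball_mem_nhds ξ one_pos, hf.2 _ isBounded_ball measurableSet_ball⟩
  obtain ⟨C, hC, h⟩ := hμ.ball_le 4 0
  have hscale : Tendsto (fun j : ℕ => 3 * scale Z (n + j)) atTop (𝓝[>] 0) := by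
    refine tendsto_nhdsWithin_iff.2 ⟨?_, Eventually.of_forall fun j => mul_pos three_pos (scale_pos _)⟩
    have h0 := (tendsto_scale (Z := Z)).const_mul (3 * (2 : ℝ) ^ (-n))
    rw [mul_zero] at h0
    refine h0.congr fun j => ?_
    rw [scale_eq (j : ℤ) (n + j), mul_assoc]
    congr 3; ring
  -- At a Lebesgue point the mean of |f - f(ξ)| over the closed ball of three times the scale tends
  -- to 0, and that ball contains, with comparable measure, every vertex ball active in the
  -- interpolation at `ξ`.
  filter_upwards [(IsUnifLocDoublingMeasure.vitaliFamily μ 1).ae_tendsto_lintegral_enorm_sub_div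
    hloc] with ξ hξ
  have hlim := hξ.comp (IsUnifLocDoublingMeasure.tendsto_closedBall_filterAt μ (fun _ => ξ) _ hscale
    (Eventually.of_forall fun j => mem_closedBall_self (by
      have := scale_pos (Z := Z) (n + j); positivity)))
  have hlim' := ENNReal.Tendsto.const_mul (a := C) hlim (Or.inr hC)
  rw [mul_zero] at hlim'
  rw [tendsto_iff_edist_tendsto_0]
  refine tendsto_of_tendsto_of_tendsto_of_le_of_le tendsto_const_nhds hlim' (fun _ => zero_le)
    fun j => ?_
  simp only [Function.comp_apply]
  rw [edist_eq_enorm_sub]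
  have hnj : X.IsFull (n + (j : ℤ)) := hn.mono (by omega)
  revert hnj
  generalize n + (j : ℤ) = k
  intro hk
  refine hμ.enorm_interp_sub_le X hk _ _ fun x hx => ?_
  refine (hμ.enorm_poisson_sub_le X hf _ _).trans ?_
  have hs := scale_pos (Z := Z) k
  have hsub : X.ball ⟨k, x⟩ ⊆ closedBall ξ (3 * scale Z k) := by
    refine (X.ball_subset _).trans (ball_subset_closedBall.trans (closedBall_subset_closedBall' ?_))
    change 2 * scale Z k + dist (x : Z) ξ ≤ _
    linarith
  have hmeas : μ (closedBall ξ (3 * scale Z k)) ≤ C * μ (X.ball ⟨k, x⟩) := by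
    have h1 := h x ξ k k (by linarith) (by simp)
    simp only [sub_self, zero_mul, ENNReal.rpow_zero, mul_one] at h1
    calc _ ≤ μ (ball ξ (4 * scale Z k)) := by
          gcongr; exact closedBall_subset_ball (by linarith)
      _ ≤ _ := h1
      _ ≤ _ := by gcongr; exact X.subset_ball ⟨k, x⟩
  have hb0 : μ (closedBall ξ (3 * scale Z k)) ≠ 0 :=
    ((hμ.ball_pos ξ _ (by positivity)).trans_le (measure_mono ball_subset_closedBall)).ne'
  have hbt : μ (closedBall ξ (3 * scale Z k)) ≠ ∞ :=
    ne_top_of_le_ne_top (ENNReal.mul_ne_top hC (hμ.measure_ne_top X _)) hmeas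
  rw [div_eq_mul_inv, div_eq_mul_inv, mul_left_comm]
  refine mul_le_mul' (lintegral_mono_set hsub) ?_
  rw [ENNReal.inv_le_iff_le_mul (fun _ => hμ.measure_ne_zero X _)
    (fun h => absurd h (hμ.measure_ne_top X _))]
  calc (1 : ℝ≥0∞) = μ (closedBall ξ (3 * scale Z k)) * (μ (closedBall ξ (3 * scale Z k)))⁻¹ :=
        (ENNReal.mul_inv_cancel hb0 hbt).symm
    _ ≤ C * μ (X.ball ⟨k, x⟩) * (μ (closedBall ξ (3 * scale Z k)))⁻¹ := by gcongr
    _ = _ := by ring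

/-- The vertices of level `n` whose tents are active at a point of `B(x)` are equal or adjacent to
`x`. -/
theorem enorm_interp_sub_value_le (u : X.Vertex → ℂ) {x : X.Vertex} {n : ℤ} (hn : X.IsFull n)
    (hx : |X.level x - n| ≤ 1) {ξ : Z} (hξ : ξ ∈ X.ball x) :
    ‖X.interp n (fun x => u ⟨n, x⟩) ξ - u x‖ₑ ≤ X.derivNorm u x := by
  refine hμ.enorm_interp_sub_le X hn _ _ fun x' hx' => ?_
  by_cases he : x = ⟨n, x'⟩
  · rw [← he]; simp
  · refine X.enorm_sub_le_derivNorm u ⟨he, hx, ξ, hξ, X.subset_ball ⟨n, x'⟩ ?_⟩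
    change dist ξ x' < scale Z n
    rwa [dist_comm]

/-- Telescope from level `n` to the almost everywhere limit `f`. Consecutive interpolations both
differ from Pf(x) by at most |d(Pf)|(x), where `x` is a vertex of the coarser level with `ξ` in its
ball; hence the factor 2. -/
theorem dominatedFrom_sub_interp {f : Z → ℂ} (hf : IsLocInt μ f) {n : ℤ} (hn : X.IsFull n) :
    X.DominatedFrom μ n (fun x => 2 * X.derivNorm (X.poisson μ f) x)
      (fun ξ => ‖(f - X.interp n fun x => X.poisson μ f ⟨n, x⟩) ξ‖ₑ) := by
  filter_upwards [hμ.ae_tendsto_interp_poisson X hf hn] with ξ hξ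
  set a : X.Vertex → ℝ≥0∞ := fun x => 2 * X.derivNorm (X.poisson μ f) x with ha
  have hsum : ∀ j : ℕ, edist (X.interp (n + j) (fun x => X.poisson μ f ⟨n + j, x⟩) ξ)
      (X.interp (n + j.succ) (fun x => X.poisson μ f ⟨n + j.succ, x⟩) ξ) ≤
      ∑' x : X.net (n + j), (X.ball ⟨n + j, x⟩).indicator
        (fun _ => X.restrict (n ≤ ·) a ⟨n + j, x⟩) ξ := by
    intro j
    have hnj : X.IsFull (n + j) := hn.mono (by omega)
    have hnj' : X.IsFull (n + (j.succ : ℕ)) := hn.mono (by omega)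
    obtain ⟨x, hx⟩ := X.exists_dist_lt hnj ξ
    have hmem : ξ ∈ X.ball ⟨n + j, x⟩ := X.subset_ball ⟨n + j, x⟩ (by
      change dist ξ x < scale Z (n + j)
      linarith [scale_pos (Z := Z) (n + j)])
    refine le_trans ?_ (ENNReal.le_tsum x)
    rw [indicator_of_mem hmem]
    have e : X.restrict (n ≤ ·) a ⟨n + j, x⟩ = a ⟨n + j, x⟩ :=
      if_pos (by change n ≤ n + (j : ℤ); omega)
    rw [e, ha]
    simp only
    rw [two_mul]
    refine (edist_triangle_right _ _ (X.poisson μ f ⟨n + j, x⟩)).trans (add_le_add ?_ ?_)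
    · rw [edist_eq_enorm_sub]
      exact hμ.enorm_interp_sub_value_le X _ hnj (by simp [HyperbolicFilling.level]) hmem
    · rw [edist_eq_enorm_sub]
      exact hμ.enorm_interp_sub_value_le X _ hnj' (by simp [HyperbolicFilling.level]) hmem
  have h0 := edist_le_tsum_of_edist_le_of_tendsto₀ _ hsum hξ
  rw [edist_comm, edist_eq_enorm_sub] at h0
  rw [X.tsum_vertex]
  refine le_trans ?_ (h0.trans (ENNReal.tsum_comp_le_tsum_of_injective
    (f := fun j : ℕ => n + (j : ℤ)) (fun i j h => by simpa using h)
    (fun m : ℤ => ∑' x : X.net m, (X.ball ⟨m, x⟩).indicator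
        (fun _ => X.restrict (n ≤ ·) a ⟨m, x⟩) ξ)))
  rw [Pi.sub_apply]
  refine le_of_eq ?_
  have e0 : ∀ m : ℤ, m = n → X.interp n (fun x => X.poisson μ f ⟨n, x⟩) ξ =
      X.interp m (fun x => X.poisson μ f ⟨m, x⟩) ξ := fun m hm => by subst hm; rfl
  rw [e0 (n + (0 : ℕ)) (by simp)]

theorem energy_sub_le (hp : 0 < p) (hq : 0 < q) : ∃ C : ℝ≥0∞, C ≠ ∞ ∧ ∀ u v w : X.Vertex → ℂ,
    X.energy μ s p q (X.derivNorm (u - w)) ≤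
      C * (X.energy μ s p q (X.derivNorm (u - v)) + X.energy μ s p q (X.derivNorm (v - w))) := by
  have := hμ.countable_vertex X
  obtain ⟨C₁, hC₁, h₁⟩ := X.energy_add_le (μ := μ) (s := s) hp hq
  obtain ⟨C₂, hC₂, h₂⟩ := hμ.derivNorm_add_le X
  refine ⟨C₂ ^ p * C₁, by finiteness, fun u v w => ?_⟩
  refine (X.energy_mono hp hq (h₂ (u - w) (u - v) (v - w) fun x y => ?_)).trans ?_
  · refine le_trans (le_of_eq ?_) (enorm_add_le _ _)
    congr 1
    simp only [Pi.sub_apply]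
    ring
  · rw [X.energy_const_mul hp hq hC₂, mul_assoc]
    gcongr
    exact h₁ _ _

/-- The energy of `f` minus its interpolation of level `n`. -/
theorem energy_sub_interp_le (hp : 0 < p) (hq : 0 < q) (hs1 : s < 1) (hσ : 0 < σ)
    (hσQ : Q * (1 - p) ≤ σ) (hσs : σ < s * p) :
    ∃ C : ℝ≥0∞, C ≠ ∞ ∧ ∀ (n : ℤ) (f : Z → ℂ), X.IsFull n → IsLocInt μ f →
      X.energy μ s p q (X.derivNorm (X.poisson μ
          (f - X.interp n fun x => X.poisson μ f ⟨n, x⟩))) ≤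
        C * (X.energy μ s p q (X.restrict (n + 5 ≤ ·) (X.derivNorm (X.poisson μ f))) +
          X.decay μ s p (s * p - σ) n (X.derivNorm (X.poisson μ f))) ∧
      X.energy μ s p q (X.derivNorm (X.poisson μ (X.interp n fun x => X.poisson μ f ⟨n, x⟩))) ≤
        C * (X.energy μ s p q (X.restrict (· < n + 5) (X.derivNorm (X.poisson μ f))) +
          X.decay μ s p (s * p - σ) n (X.derivNorm (X.poisson μ f))) := by
  have := hμ.countable_vertex X
  obtain ⟨C₁, hC₁, h₁⟩ := X.energy_add_le (μ := μ) (s := s) hp hq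
  obtain ⟨C₂, hC₂, h₂⟩ := hμ.derivNorm_add_le X
  obtain ⟨C₃, hC₃, h₃⟩ := hμ.energy_low_le X hp hq hσ hσQ hσs 5
  obtain ⟨C₄, hC₄, h₄⟩ := hμ.energy_high_le X (δ := s * p - σ) hp hq hs1
  obtain ⟨C₅, hC₅, h₅⟩ := hμ.lipschitzAtLevel_interp_poisson X
  set K : ℝ≥0∞ := C₃ * 2 ^ p + C₄ * C₅ ^ p with hK
  have hKt : K ≠ ∞ := by have := two_rpow_ne_top p; finiteness
  refine ⟨C₁ * ((1 + C₂) ^ p * C₁ * (1 + K) + K), by finiteness, fun n f hn hf => ?_⟩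
  set T := X.interp n fun x => X.poisson μ f ⟨n, x⟩ with hT
  have hTint : IsLocInt μ T := hμ.isLocInt_interp X hn _
  set w := X.derivNorm (X.poisson μ f) with hw
  set D := X.decay μ s p (s * p - σ) n w with hD
  have hlow : X.energy μ s p q (X.restrict (· < n + 5) (X.derivNorm (X.poisson μ (f - T)))) ≤
      K * D := by
    refine (h₃ n _ _ (hμ.dominatedFrom_sub_interp X hf hn)).trans ?_
    rw [X.decay_const_mul hp.le, ← mul_assoc]
    gcongr
    exact le_self_add
  have hhigh : X.energy μ s p q (X.restrict (n + 5 ≤ ·) (X.derivNorm (X.poisson μ T))) ≤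
      K * D := by
    refine (h₄ n _ _ hn hTint (h₅ n _ hn)).trans ?_
    rw [X.decay_const_mul hp.le, ← mul_assoc]
    gcongr
    exact le_add_self
  have hsub : ∀ x, X.poisson μ (f - T) x = X.poisson μ f x - X.poisson μ T x :=
    poisson_sub X hf hTint
  -- the energy of a part of a sequence that is controlled by two others
  have haux : ∀ (P : ℤ → Prop) (u v : X.Vertex → ℂ),
      (∀ x y, ‖u y - u x‖ₑ ≤ ‖X.poisson μ f y - X.poisson μ f x‖ₑ + ‖v y - v x‖ₑ) →
      X.energy μ s p q (X.restrict P (X.derivNorm v)) ≤ K * D →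
      X.energy μ s p q (X.restrict P (X.derivNorm u)) ≤
        (1 + C₂) ^ p * C₁ * (1 + K) * (X.energy μ s p q (X.restrict P w) + D) := by
    intro P u v huv hv
    calc X.energy μ s p q (X.restrict P (X.derivNorm u))
        ≤ X.energy μ s p q (fun x => (1 + C₂) *
            (X.restrict P w x + X.restrict P (X.derivNorm v) x)) := by
          refine X.energy_mono hp hq fun x => ?_
          unfold HyperbolicFilling.restrict
          split_ifs
          · exact (h₂ u _ v huv x).trans (by gcongr; exact le_add_self)
          · exact zero_le
      _ = (1 + C₂) ^ p * X.energy μ s p q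
            (fun x => X.restrict P w x + X.restrict P (X.derivNorm v) x) :=
          X.energy_const_mul hp hq (by finiteness) _
      _ ≤ (1 + C₂) ^ p * (C₁ * (X.energy μ s p q (X.restrict P w) + K * D)) := by
          gcongr
          exact (h₁ _ _).trans (by gcongr)
      _ ≤ (1 + C₂) ^ p * (C₁ * ((1 + K) * (X.energy μ s p q (X.restrict P w) + D))) := by
          gcongr
          rw [mul_add, add_mul 1 K D, add_mul 1 K, one_mul, one_mul]
          gcongr
          · exact le_self_add
          · exact le_add_self
      _ = _ := by ring
  have hsplit : ∀ (u : X.Vertex → ℝ≥0∞), X.energy μ s p q u ≤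
      C₁ * (X.energy μ s p q (X.restrict (· < n + 5) u) +
        X.energy μ s p q (X.restrict (n + 5 ≤ ·) u)) := by
    intro u
    refine (X.energy_mono hp hq fun x => ?_).trans (h₁ _ _)
    unfold HyperbolicFilling.restrict
    rcases lt_or_ge (X.level x) (n + 5) with h | h
    · rw [if_pos h]; exact le_self_add
    · rw [if_pos h]; exact le_add_self
  have hadd : ∀ A E : ℝ≥0∞, A * (E + D) + K * D ≤ (A + K) * (E + D) := by
    intro A E
    rw [add_mul A K]
    gcongr
    exact le_add_self
  -- For `f - T` the low levels are bounded by domination and the high ones through `f` and `T`; for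
  -- `T` the high levels are bounded by the Lipschitz property and the low ones through `f` and `f -
  -- T`.
  constructor
  · refine (hsplit _).trans ?_
    rw [mul_assoc C₁, add_comm]
    gcongr
    refine (add_le_add (haux _ _ (X.poisson μ T) (fun x y => ?_) hhigh) hlow).trans (hadd _ _)
    rw [hsub, hsub]
    refine le_trans (le_of_eq ?_) enorm_sub_le
    congr 1; ring
  · refine (hsplit _).trans ?_
    rw [mul_assoc C₁]
    gcongr
    refine (add_le_add (haux _ _ (X.poisson μ (f - T)) (fun x y => ?_) hlow) hhigh).trans (hadd _ _)
    rw [hsub, hsub]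
    refine le_trans (le_of_eq ?_) enorm_sub_le
    congr 1; ring

/-- Each level has mass at most a constant times the energy, and the weights are summable. The first
bound serves n → ∞; the second, split at an auxiliary level `l`, serves n → -∞. -/
theorem decay_le_energy (hp : 0 < p) (hq : 0 < q) (hδ : 0 < δ) :
    ∃ C : ℝ≥0∞, C ≠ ∞ ∧ ∀ (n l : ℤ) (w : X.Vertex → ℝ≥0∞),
      X.decay μ s p δ n w ≤ C * X.energy μ s p q (X.restrict (n ≤ ·) w) ∧
      X.decay μ s p δ n w ≤ C * (X.energy μ s p q (X.restrict (· < l) w) +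
        2 ^ (-δ * ((l : ℝ) - n)) * X.energy μ s p q w) := by
  obtain ⟨C₁, hC₁, h₁⟩ := hμ.mass_le_energy X (s := s) hp hq
  obtain ⟨C₂, hC₂, h₂⟩ := tsum_two_rpow_abs hδ
  refine ⟨C₁ * C₂, by finiteness, fun n l w => ?_⟩
  have hlev : ∀ k : ℤ, ∑' x : X.net k, (2 : ℝ≥0∞) ^ (-δ * ((X.level ⟨k, x⟩ : ℝ) - n)) *
      X.mass μ s p (X.restrict (n ≤ ·) w) ⟨k, x⟩ =
      2 ^ (-δ * ((k : ℝ) - n)) * ∑' x : X.net k, X.mass μ s p (X.restrict (n ≤ ·) w) ⟨k, x⟩ :=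
    fun k => by rw [← ENNReal.tsum_mul_left]; rfl
  have hlow : ∀ k < n, ∑' x : X.net k, X.mass μ s p (X.restrict (n ≤ ·) w) ⟨k, x⟩ = 0 := by
    intro k hk
    rw [ENNReal.tsum_eq_zero]
    intro x
    have : ¬ n ≤ X.level ⟨k, x⟩ := not_le.2 hk
    simp [HyperbolicFilling.mass, HyperbolicFilling.restrict, this, hp]
  unfold HyperbolicFilling.decay
  rw [X.tsum_vertex]
  simp only [hlev]
  constructor
  · calc _ ≤ ∑' k : ℤ, (2 : ℝ≥0∞) ^ (-δ * |(k : ℝ) - n|) *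
          (C₁ * X.energy μ s p q (X.restrict (n ≤ ·) w)) := by
          refine ENNReal.tsum_le_tsum fun k => ?_
          rcases lt_or_ge k n with hk | hk
          · rw [hlow k hk, mul_zero]; exact zero_le
          · have hk' : (n : ℝ) ≤ k := by exact_mod_cast hk
            rw [abs_of_nonneg (by linarith)]
            gcongr
            exact h₁ k _
      _ ≤ C₂ * (C₁ * X.energy μ s p q (X.restrict (n ≤ ·) w)) := by
          rw [ENNReal.tsum_mul_right]; gcongr; exact h₂ n
      _ = _ := by ring
  · set E₁ := X.energy μ s p q (X.restrict (· < l) w) with hE₁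
    set E₂ := X.energy μ s p q w with hE₂
    calc _ ≤ ∑' k : ℤ, ((2 : ℝ≥0∞) ^ (-δ * |(k : ℝ) - n|) * (C₁ * E₁) +
          2 ^ (-δ * |(k : ℝ) - l|) * (C₁ * (2 ^ (-δ * ((l : ℝ) - n)) * E₂))) := by
          refine ENNReal.tsum_le_tsum fun k => ?_
          rcases lt_or_ge k n with hk | hk
          · rw [hlow k hk, mul_zero]; exact zero_le
          have hk' : (n : ℝ) ≤ k := by exact_mod_cast hk
          rcases lt_or_ge k l with hkl | hkl
          · refine le_trans ?_ le_self_add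
            rw [abs_of_nonneg (by linarith)]
            gcongr
            refine le_trans (ENNReal.tsum_le_tsum fun x => X.mass_mono hp.le ?_) (h₁ k _)
            unfold HyperbolicFilling.restrict
            rw [if_pos (show X.level ⟨k, x⟩ < l from hkl)]
            exact X.restrict_le _ _ _
          · refine le_trans ?_ le_add_self
            have hkl' : (l : ℝ) ≤ k := by exact_mod_cast hkl
            rw [abs_of_nonneg (by linarith : 0 ≤ (k : ℝ) - l),
              show (2 : ℝ≥0∞) ^ (-δ * ((k : ℝ) - l)) * (C₁ * (2 ^ (-δ * ((l : ℝ) - n)) * E₂)) =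
              (2 ^ (-δ * ((k : ℝ) - l)) * 2 ^ (-δ * ((l : ℝ) - n))) * (C₁ * E₂) by ring,
              ← two_rpow_add, show -δ * ((k : ℝ) - l) + -δ * ((l : ℝ) - n) = -δ * ((k : ℝ) - n) by ring]
            gcongr
            exact le_trans (ENNReal.tsum_le_tsum fun x => X.mass_mono hp.le (X.restrict_le _ _ _))
              (h₁ k _)
      _ ≤ C₂ * (C₁ * E₁) + C₂ * (C₁ * (2 ^ (-δ * ((l : ℝ) - n)) * E₂)) := by
          rw [ENNReal.tsum_add, ENNReal.tsum_mul_right, ENNReal.tsum_mul_right]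
          gcongr
          · exact h₂ n
          · exact h₂ l
      _ = _ := by ring

theorem tendsto_decay_atTop (hp : 0 < p) (hq : 0 < q) (hδ : 0 < δ) {w : X.Vertex → ℝ≥0∞}
    (hw : X.energy μ s p q w ≠ ∞) : Tendsto (fun n => X.decay μ s p δ n w) atTop (𝓝 0) := by
  have := hμ.countable_vertex X
  obtain ⟨C, hC, h⟩ := hμ.decay_le_energy X (s := s) hp hq hδ
  have h1 := ENNReal.Tendsto.const_mul (a := C) (X.tendsto_energy_restrict hp hq (l := atTop)
    (P := fun n k => n ≤ k) (fun k => by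
      filter_upwards [eventually_gt_atTop k] with n hn using not_le.2 hn) hw) (Or.inr hC)
  rw [mul_zero] at h1
  exact tendsto_of_tendsto_of_tendsto_of_le_of_le tendsto_const_nhds h1 (fun _ => zero_le)
    fun n => (h n 0 w).1

/-- First fix `l` so that the levels below `l` carry little energy; then the weight 2^{-δ(l-n)}
disposes of the others. -/
theorem tendsto_decay_atBot (hp : 0 < p) (hq : 0 < q) (hδ : 0 < δ) {w : X.Vertex → ℝ≥0∞}
    (hw : X.energy μ s p q w ≠ ∞) : Tendsto (fun n => X.decay μ s p δ n w) atBot (𝓝 0) := by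
  have := hμ.countable_vertex X
  obtain ⟨C, hC, h⟩ := hμ.decay_le_energy X (s := s) hp hq hδ
  have h1 := ENNReal.Tendsto.const_mul (a := C) (X.tendsto_energy_restrict hp hq (l := atBot)
    (P := fun n k => k < n) (fun k => by
      filter_upwards [eventually_le_atBot k] with n hn using not_lt.2 hn) hw) (Or.inr hC)
  rw [mul_zero] at h1
  refine ENNReal.tendsto_nhds_zero.2 fun ε hε => ?_
  have hε2 : 0 < ε / 2 := ENNReal.half_pos hε.ne'
  obtain ⟨l, hl⟩ := (ENNReal.tendsto_nhds_zero.1 h1 _ hε2).exists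
  obtain ⟨C₂, hC₂, h₂⟩ := tsum_two_rpow_abs hδ
  have h3 : Tendsto (fun n : ℤ => (2 : ℝ≥0∞) ^ (-δ * |(n : ℝ) - l|)) atBot (𝓝 0) :=
    (ENNReal.tendsto_cofinite_zero_of_tsum_ne_top (ne_top_of_le_ne_top hC₂ (h₂ l))).mono_left
      (by rw [Int.cofinite_eq]; exact le_sup_left)
  have h4 := ENNReal.Tendsto.const_mul (a := C * X.energy μ s p q w) h3
    (Or.inr (ENNReal.mul_ne_top hC hw))
  rw [mul_zero] at h4
  filter_upwards [ENNReal.tendsto_nhds_zero.1 h4 _ hε2, eventually_le_atBot l] with n hn hnl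
  have hnl' : (n : ℝ) ≤ l := by exact_mod_cast hnl
  rw [abs_of_nonpos (by linarith), neg_sub] at hn
  refine ((h n l w).2).trans ?_
  rw [mul_add]
  refine (add_le_add hl (le_trans (le_of_eq (by ring)) hn)).trans (ENNReal.add_halves ε).le

end IsDoublingMeasure

end Approximation

/-! ### Density of the Lipschitz functions with bounded support -/

section Density

variable {Z : Type*} [MetricSpace Z] (X : HyperbolicFilling Z)
variable [MeasurableSpace Z] [BorelSpace Z] {μ : Measure Z} {s p q Q σ : ℝ}

namespace IsDoublingMeasure

variable (hμ : IsDoublingMeasure μ Q)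
include hμ

theorem energy_lipBounded_ne_top (hp : 0 < p) (hq : 0 < q) (hs1 : s < 1) (hσ : 0 < σ)
    (hσQ : Q * (1 - p) ≤ σ) (hσs : σ < s * p) {g : Z → ℂ} (hg : g ∈ lipBounded Z) :
    IsLocInt μ g ∧ X.energy μ s p q (X.derivNorm (X.poisson μ g)) ≠ ∞ := by
  have := hμ.secondCountable X
  obtain ⟨⟨K, hK⟩, hb⟩ := hg
  have hfull : X.IsFull 1 := fun _ => le_rfl
  -- An empty space would be bounded, and the single vertex of level 0 would provide a point.
  obtain ⟨o⟩ : Nonempty Z := by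
    by_contra hZ
    rw [not_nonempty_iff] at hZ
    obtain ⟨z, -⟩ := X.net_zero ⟨Bornology.IsBounded.subset Bornology.isBounded_empty
      (fun z _ => hZ.elim z)⟩
    exact hZ.elim z
  obtain ⟨R, hR⟩ := hb.subset_ball o
  have hzero : ∀ ξ, R ≤ dist ξ o → g ξ = 0 := fun ξ hξ => by
    by_contra h
    exact absurd (mem_ball.1 (hR h)) (not_lt.2 hξ)
  have hlip : ∀ ξ η, ‖g ξ - g η‖ ≤ K * dist ξ η := fun ξ η => by
    rw [← dist_eq_norm]; exact hK.dist_le_mul ξ η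
  set B : ℝ := ‖g o‖ + K * |R| with hB
  have hbound : ∀ ξ, ‖g ξ‖ ≤ B := by
    intro ξ
    rcases le_or_gt R (dist ξ o) with h | h
    · rw [hzero ξ h, norm_zero]; positivity
    · have h1 := hlip ξ o
      have h2 : ‖g ξ‖ ≤ ‖g o‖ + ‖g ξ - g o‖ := by
        simpa using norm_add_le (g o) (g ξ - g o)
      have h3 : K * dist ξ o ≤ K * |R| := by
        gcongr; exact h.le.trans (le_abs_self R)
      linarith
  have hloc : IsLocInt μ g :=
    hμ.isLocInt_of_continuous hK.continuous fun _ _ => ⟨B, fun ξ _ => hbound ξ⟩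
  refine ⟨hloc, ?_⟩
  have hs := scale_pos (Z := Z) 1
  set A : ℝ≥0∞ := ENNReal.ofReal (B + K * scale Z 1) with hA
  -- Constant near the support and zero elsewhere; on level 1 this involves finitely many vertices,
  -- so the `decay` bound is finite. In `A`, the summand `B` gives the domination and `K * scale Z
  -- 1` the Lipschitz condition.
  set b : X.Vertex → ℝ≥0∞ := fun y => if dist (X.center y) o < R + scale Z 1 then A else 0 with hb'
  have hval : ∀ x : X.net 1, dist (x : Z) o < R + scale Z 1 →
      X.restrict (· = 1) b ⟨1, x⟩ = A := fun x hx => by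
    have e : X.restrict (· = 1) b ⟨1, x⟩ = b ⟨1, x⟩ := if_pos rfl
    rw [e]; exact if_pos hx
  obtain ⟨C, hC, h⟩ := hμ.energy_le_decay X (s := s) hp hq hs1 hσ hσQ hσs
  refine ne_top_of_le_ne_top ?_ (h 1 (X.restrict (· = 1) b) g hfull hloc ?_ ?_)
  · refine ENNReal.mul_ne_top hC (ne_top_of_le_ne_top ?_ (X.decay_restrict_level_le hp 1 b))
    obtain ⟨F, hF⟩ := hμ.exists_near_finset X 1 o (R + scale Z 1)
    rw [tsum_eq_sum (s := F) fun x hx => ?_]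
    · refine ENNReal.sum_ne_top.2 fun x _ => ?_
      rw [X.mass_eq hp.le]
      have h1 := two_rpow_ne_top ((X.level ⟨1, x⟩ : ℝ) * s * p)
      have h2 := hμ.measure_ne_top X ⟨1, x⟩
      have h3 : b ⟨1, x⟩ ≠ ∞ := by simp only [hb']; split_ifs <;> simp [hA]
      finiteness
    · have h3 : b ⟨1, x⟩ = 0 := if_neg fun h => hx ((hF x).2 h)
      simp [HyperbolicFilling.mass, h3, hp]
  · refine Eventually.of_forall fun ξ => ?_
    rcases le_or_gt R (dist ξ o) with hξ | hξ
    · simp [hzero ξ hξ]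
    obtain ⟨x, hx⟩ := X.exists_dist_lt hfull ξ
    refine le_trans ?_ (ENNReal.le_tsum ⟨1, x⟩)
    rw [indicator_of_mem (X.subset_ball ⟨1, x⟩ (by
      change dist ξ x < scale Z 1; linarith))]
    have e : X.restrict (1 ≤ ·) (X.restrict (· = 1) b) ⟨1, x⟩ = X.restrict (· = 1) b ⟨1, x⟩ :=
      if_pos le_rfl
    rw [e, hval x (by linarith [dist_triangle_left (x : Z) o ξ]), hA]
    change ‖g ξ‖ₑ ≤ _
    rw [← ofReal_norm]
    refine ENNReal.ofReal_le_ofReal ((hbound ξ).trans ?_)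
    have : 0 ≤ K * scale Z 1 := by positivity
    linarith
  · intro x ξ η hξ hη
    by_cases hx : dist (x : Z) o < R + scale Z 1
    · rw [hval x hx, hA, ← ENNReal.ofReal_mul (by positivity), ← ofReal_norm]
      refine ENNReal.ofReal_le_ofReal ((hlip ξ η).trans ?_)
      have hB0 : 0 ≤ B := by positivity
      have : 0 ≤ dist ξ η / scale Z 1 * B := by positivity
      calc K * dist ξ η = dist ξ η / scale Z 1 * (K * scale Z 1) := by field_simp
        _ ≤ _ := by rw [mul_add]; linarith
    · have h1 : R ≤ dist ξ o := by
        by_contra h'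
        exact hx (by linarith [dist_triangle_left (x : Z) o ξ])
      have h2 : R ≤ dist η o := by
        by_contra h'
        exact hx (by linarith [dist_triangle_left (x : Z) o η, dist_triangle_left η (x : Z) ξ])
      simp [hzero ξ h1, hzero η h2]

/-- A function of finite energy can be approximated by functions of finite energy whose averages at
every level are summable. -/
theorem exists_summable_approx (hp : 0 < p) (hq : 0 < q) (hs1 : s < 1) (hσ : 0 < σ)
    (hσQ : Q * (1 - p) ≤ σ) (hσs : σ < s * p) {f : Z → ℂ} (hf : IsLocInt μ f)
    (hfe : X.energy μ s p q (X.derivNorm (X.poisson μ f)) ≠ ∞) {ε : ℝ≥0∞} (hε : 0 < ε) :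
    ∃ g : Z → ℂ, IsLocInt μ g ∧ X.energy μ s p q (X.derivNorm (X.poisson μ g)) ≠ ∞ ∧
      X.energy μ s p q (X.derivNorm (X.poisson μ f - X.poisson μ g)) ≤ ε ∧
      ∀ N : ℤ, X.IsFull N → ∑' x : X.net N, ‖X.poisson μ g ⟨N, x⟩‖ₑ ^ p * μ (X.ball ⟨N, x⟩) ≠ ∞ := by
  have := hμ.countable_vertex X
  -- In a bounded space every net is finite, so `f` itself will do.
  by_cases hZ : BoundedSpace Z
  · refine ⟨f, hf, hfe, ?_, fun N hN => ?_⟩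
    · have : X.derivNorm (X.poisson μ f - X.poisson μ f) = fun _ => 0 := by
        ext x; simp [HyperbolicFilling.derivNorm]
      rw [this]
      simp [HyperbolicFilling.energy, hq, div_pos hp hq]
    · obtain ⟨o, -⟩ := X.net_zero hZ
      obtain ⟨R, hR⟩ := (Bornology.IsBounded.all (univ : Set Z)).subset_ball o
      obtain ⟨F, hF⟩ := hμ.exists_near_finset X N o R
      rw [tsum_eq_sum (s := F) fun x hx => absurd ((hF x).2 (hR (mem_univ _))) hx]
      refine ENNReal.sum_ne_top.2 fun x _ => ?_
      have h2 := hμ.measure_ne_top X ⟨N, x⟩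
      finiteness
  · have hfull : ∀ n, X.IsFull n := fun n h => absurd h hZ
    have hδ : 0 < s * p - σ := by linarith
    obtain ⟨C₁, hC₁, h₁⟩ := hμ.energy_sub_interp_le X (s := s) hp hq hs1 hσ hσQ hσs
    obtain ⟨C₂, hC₂, h₂⟩ := hμ.decay_le_energy X (s := s) hp hq hδ
    obtain ⟨C₃, hC₃, h₃⟩ := X.energy_add_le (μ := μ) (s := s) hp hq
    set w := X.derivNorm (X.poisson μ f) with hw
    have hlim : Tendsto (fun n : ℤ => C₁ * (X.energy μ s p q (X.restrict (· < n + 5) w) +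
        X.decay μ s p (s * p - σ) n w)) atBot (𝓝 0) := by
      have h := ENNReal.Tendsto.const_mul (a := C₁) ((X.tendsto_energy_restrict hp hq (l := atBot)
        (P := fun n k => k < n + 5) (fun k => by
          filter_upwards [eventually_le_atBot (k - 5)] with n hn using by omega) hfe).add
        (hμ.tendsto_decay_atBot X hp hq hδ hfe)) (Or.inr hC₁)
      simpa using h
    obtain ⟨n, hn⟩ := (ENNReal.tendsto_nhds_zero.1 hlim ε hε).exists
    have hdecay : X.decay μ s p (s * p - σ) n w ≠ ∞ := by
      refine ne_top_of_le_ne_top ?_ (h₂ n n w).1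
      exact ENNReal.mul_ne_top hC₂ (ne_top_of_le_ne_top hfe
        (X.energy_mono hp hq (X.restrict_le _ _)))
    set T := X.interp n fun x => X.poisson μ f ⟨n, x⟩ with hT
    have hTint : IsLocInt μ T := hμ.isLocInt_interp X (hfull n) _
    have hsub : ∀ x, X.poisson μ (f - T) x = X.poisson μ f x - X.poisson μ T x :=
      poisson_sub X hf hTint
    refine ⟨f - T, hf.sub hTint, ?_, ?_, fun N _ => ?_⟩
    · refine ne_top_of_le_ne_top ?_ (h₁ n f (hfull n) hf).1
      exact ENNReal.mul_ne_top hC₁ (ENNReal.add_ne_top.2 ⟨ne_top_of_le_ne_top hfe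
        (X.energy_mono hp hq (X.restrict_le _ _)), hdecay⟩)
    · have e : X.poisson μ f - X.poisson μ (f - T) = X.poisson μ T := by
        ext x; rw [Pi.sub_apply, hsub]; ring
      rw [e]
      exact (h₁ n f (hfull n) hf).2.trans hn
    -- `f - T` is dominated from level `n` on, and the averaging estimate reaches any fixed number
    -- of levels above `n`. Its constant depends on `N - n`, which is harmless as only finiteness is
    -- needed.
    · obtain ⟨C₄, hC₄, h₄⟩ := hμ.level_bigAvg_le X (s := s) hp hσ hσQ (N - n).toNat
      have hlev := h₄ n N _ _ (hμ.dominatedFrom_sub_interp X hf (hfull n)) (by omega)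
      have hfin : ∑' x : X.net N, X.mass μ s p (fun x => ‖X.poisson μ (f - T) x‖ₑ) ⟨N, x⟩ ≠ ∞ := by
        refine ne_top_of_le_ne_top ?_ (le_trans (ENNReal.tsum_le_tsum fun x =>
          X.mass_mono hp.le (hμ.enorm_poisson_le_bigAvg X (f - T) ⟨N, x⟩)) hlev)
        rw [X.decay_const_mul hp.le]
        have h5 := two_rpow_ne_top (-(s * p - σ) * ((n : ℝ) - N))
        have h6 := two_rpow_ne_top p
        finiteness
      have e : ∑' x : X.net N, X.mass μ s p (fun x => ‖X.poisson μ (f - T) x‖ₑ) ⟨N, x⟩ =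
          2 ^ ((N : ℝ) * s * p) *
            ∑' x : X.net N, ‖X.poisson μ (f - T) ⟨N, x⟩‖ₑ ^ p * μ (X.ball ⟨N, x⟩) := by
        rw [← ENNReal.tsum_mul_left]
        exact tsum_congr fun x => X.mass_eq hp.le _ _
      rw [e] at hfin
      intro htop
      rw [htop, ENNReal.mul_top (two_rpow_ne_zero _)] at hfin
      exact hfin rfl

theorem exists_lipBounded_approx (hp : 0 < p) (hq : 0 < q) (hs1 : s < 1) (hσ : 0 < σ)
    (hσQ : Q * (1 - p) ≤ σ) (hσs : σ < s * p) {f : Z → ℂ} (hf : IsLocInt μ f)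
    (hfe : X.energy μ s p q (X.derivNorm (X.poisson μ f)) ≠ ∞) {ε : ℝ≥0∞} (hε : 0 < ε) :
    ∃ g ∈ lipBounded Z, X.energy μ s p q (X.derivNorm (X.poisson μ (f - g))) ≤ ε := by
  classical
  have := hμ.countable_vertex X
  have hδ : 0 < s * p - σ := by linarith
  obtain ⟨C, hC, htri⟩ := hμ.energy_sub_le X (s := s) hp hq
  -- Two quasi-triangle inequalities link f, g, the interpolation of g and its truncation.
  obtain ⟨ε', hε', hεC⟩ : ∃ ε' : ℝ≥0∞, 0 < ε' ∧ C * (ε' + C * (ε' + ε')) ≤ ε := by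
    have hlim : Tendsto (fun t : ℝ≥0∞ => C * (t + C * (t + t))) (𝓝 0) (𝓝 0) := by
      have h1 : Tendsto (fun t : ℝ≥0∞ => t) (𝓝 0) (𝓝 0) := tendsto_id
      have h2 := ENNReal.Tendsto.const_mul (a := C) (h1.add (ENNReal.Tendsto.const_mul (a := C)
        (h1.add h1) (Or.inr hC))) (Or.inr hC)
      simpa using h2
    obtain ⟨t, ht, h0⟩ := ((ENNReal.tendsto_nhds_zero.1 hlim ε hε).filter_mono
      nhdsWithin_le_nhds).and (self_mem_nhdsWithin : Ioi (0 : ℝ≥0∞) ∈ 𝓝[>] 0) |>.exists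
    exact ⟨t, h0, ht⟩
  obtain ⟨g, hg, hge, hfg, hsum⟩ := hμ.exists_summable_approx X hp hq hs1 hσ hσQ hσs hf hfe hε'
  set w := X.derivNorm (X.poisson μ g) with hw
  obtain ⟨C₁, hC₁, h₁⟩ := hμ.energy_sub_interp_le X (s := s) hp hq hs1 hσ hσQ hσs
  have hlim : Tendsto (fun n : ℤ => C₁ * (X.energy μ s p q (X.restrict (n + 5 ≤ ·) w) +
      X.decay μ s p (s * p - σ) n w)) atTop (𝓝 0) := by
    have h := ENNReal.Tendsto.const_mul (a := C₁) ((X.tendsto_energy_restrict hp hq (l := atTop)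
      (P := fun n k => n + 5 ≤ k) (fun k => by
        filter_upwards [eventually_ge_atTop k] with n hn using by omega) hge).add
      (hμ.tendsto_decay_atTop X hp hq hδ hge)) (Or.inr hC₁)
    simpa using h
  obtain ⟨N, hN, hN1⟩ := ((ENNReal.tendsto_nhds_zero.1 hlim ε' hε').and
    (eventually_ge_atTop 1)).exists
  have hfull : X.IsFull N := fun _ => hN1
  set c : X.net N → ℂ := fun x => X.poisson μ g ⟨N, x⟩ with hc
  obtain ⟨C₂, hC₂, h₂⟩ := hμ.energy_interp_le X (s := s) (q := q) hp hq hs1 hσ hσQ hσs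
  have hcount := hμ.countable_net X N
  have hlim2 := ENNReal.Tendsto.const_mul (a := C₂ * 2 ^ ((N : ℝ) * s * p))
    (tendsto_tsum_zero_of_eventually (l := atTop) (hsum N hfull)
      (F := fun (F : Finset (X.net N)) x => if x ∈ F then 0 else ‖c x‖ₑ ^ p * μ (X.ball ⟨N, x⟩))
      (fun F x => by
        split_ifs
        · exact zero_le
        · exact le_rfl)
      (fun x => by
        filter_upwards [eventually_ge_atTop {x}] with F hF
        rw [if_pos (hF (Finset.mem_singleton_self x))]))
    (Or.inr (ENNReal.mul_ne_top hC₂ (two_rpow_ne_top _)))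
  rw [mul_zero] at hlim2
  -- The tail of the convergent series of coefficients outside a large finite `F` bounds the energy
  -- of what the truncation removes.
  obtain ⟨F, hF⟩ := (ENNReal.tendsto_nhds_zero.1 hlim2 ε' hε').exists
  set c' : X.net N → ℂ := fun x => if x ∈ F then c x else 0 with hc'
  have hT := hμ.isLocInt_interp X hfull c
  have hT' := hμ.isLocInt_interp X hfull c'
  refine ⟨X.interp N c', hμ.interp_mem_lipBounded X hfull c' F fun x hx => if_neg hx, ?_⟩
  have e : ∀ {u v : Z → ℂ}, IsLocInt μ u → IsLocInt μ v →
      X.poisson μ (u - v) = X.poisson μ u - X.poisson μ v :=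
    fun hu hv => funext (poisson_sub X hu hv)
  rw [e hf hT']
  have h3 : X.energy μ s p q (X.derivNorm (X.poisson μ g - X.poisson μ (X.interp N c))) ≤ ε' := by
    rw [← e hg hT]
    exact (h₁ N g hfull hg).1.trans hN
  have h4 : X.energy μ s p q (X.derivNorm (X.poisson μ (X.interp N c) -
      X.poisson μ (X.interp N c'))) ≤ ε' := by
    rw [← e hT hT', hμ.interp_sub_interp X]
    refine (h₂ N (c - c') hfull).trans (le_trans (le_of_eq ?_) hF)
    rw [mul_assoc C₂]
    refine congrArg _ (congrArg _ (tsum_congr fun x => ?_))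
    simp only [Pi.sub_apply, hc']
    split_ifs <;> simp [hp]
  calc _ ≤ _ := htri _ (X.poisson μ g) _
    _ ≤ C * (ε' + C * (ε' + ε')) := by
        gcongr
        exact (htri _ (X.poisson μ (X.interp N c)) _).trans (by gcongr)
    _ ≤ ε := hεC

end IsDoublingMeasure

end Density

end TriebelLizorkin

/-! ### The theorem -/

open TriebelLizorkin in
theorem corollary3p4 {Z : Type*} [MetricSpace Z] [MeasurableSpace Z] [BorelSpace Z]
    (μ : Measure Z) (Q : ℝ) (hμ : IsDoublingMeasure μ Q) (X : HyperbolicFilling Z)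
    (s p q : ℝ) (hs0 : 0 < s) (hs1 : s < 1) (hp : Q / (Q + s) < p) (hq : Q / (Q + s) < q) :
    lipBounded Z ⊆ tlSpace μ X s p q ∧
    ∀ f ∈ tlSpace μ X s p q, ∀ ε : ℝ≥0∞, 0 < ε →
      ∃ g ∈ lipBounded Z, X.tlNorm μ s p q (f - g) < ε := by
  have hQ := hμ.exponent_pos
  have hQs : 0 < Q / (Q + s) := by positivity
  have hp0 : 0 < p := hQs.trans hp
  have hq0 : 0 < q := hQs.trans hq
  rw [div_lt_iff₀ (by positivity)] at hp
  -- Q < p(Q+s) rearranges to Q(1-p) < sp.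
  obtain ⟨σ, hσ1, hσs⟩ : ∃ σ, max 0 (Q * (1 - p)) < σ ∧ σ < s * p :=
    exists_between (max_lt (by positivity) (by linarith))
  have hσ : 0 < σ := (le_max_left _ _).trans_lt hσ1
  have hσQ : Q * (1 - p) ≤ σ := ((le_max_right _ _).trans_lt hσ1).le
  have hnorm : ∀ f : Z → ℂ, X.tlNorm μ s p q f =
      X.energy μ s p q (X.derivNorm (X.poisson μ f)) ^ (1 / p) := fun f => X.seqNorm_eq _
  constructor
  · intro g hg
    obtain ⟨h1, h2⟩ := hμ.energy_lipBounded_ne_top X hp0 hq0 hs1 hσ hσQ hσs hg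
    refine ⟨h1, ?_⟩
    rw [hnorm]
    exact ENNReal.rpow_lt_top_of_nonneg (by positivity) h2
  · intro f hf ε hε
    have hfe : X.energy μ s p q (X.derivNorm (X.poisson μ f)) ≠ ∞ := fun h => by
      have h2 := hf.2
      rw [hnorm, h, ENNReal.top_rpow_of_pos (by positivity)] at h2
      exact lt_irrefl _ h2
    obtain ⟨η, hη0, hηε⟩ := exists_between hε
    obtain ⟨g, hg, hge⟩ := hμ.exists_lipBounded_approx X hp0 hq0 hs1 hσ hσQ hσs hf.1 hfe
      (ENNReal.rpow_pos_of_nonneg hη0 hp0.le)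
    refine ⟨g, hg, ?_⟩
    rw [hnorm]
    calc _ ≤ (η ^ p) ^ (1 / p) := ENNReal.rpow_le_rpow hge (by positivity)
      _ = η := by rw [← ENNReal.rpow_mul, mul_one_div_cancel hp0.ne', ENNReal.rpow_one]
      _ < ε := hηε
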